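/- For a lattice $\Lambda\subset\mathbb{R}^2$ of full rank let $\operatorname{disp}(\Lambda)\in(0,\infty]$ be the supremum of the areas of the open axis-parallel boxes $(x_1,x_2)\times(y_1,y_2)$ that contain no point of $\Lambda$, and call $\operatorname{disp}(\Lambda)/\det(\Lambda)$ its normalized dispersion. The lattice generated by a matrix is the set of integer combinations of its columns. Two invertible real $2\times2$ matrices are called equivalent if one is obtained from the other by finitely many multiplications from the left by invertible diagonal matrices or by $\begin{pmatrix}0&1\\1&0\end{pmatrix}$ and from the right by elements of $\mathrm{GL}_2(\mathbb{Z})$; equivalent matrices generate lattices with the same normalized dispersion. Let $\varphi=(1+\sqrt5)/2$ and $\overline\varphi=1-\varphi$, and write $[a_0,a_1,a_2,\dots]$ for the regular continued fraction with coefficients $a_i$, with a bar over a period. Theorem. Consider the set of the normalized dispersions of all lattices of full rank in $\mathbb{R}^2$. (1) Its smallest element is the normalized dispersion of the lattice $\Lambda_5$ generated by $\begin{pmatrix}1&\varphi\\1&\overline\varphi\end{pmatrix}$, and $$\frac{\operatorname{disp}(\Lambda_5)}{\det(\Lambda_5)}=\frac{\varphi^3}{\sqrt5}=1.89442\dots$$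 (2) Its second smallest element is the normalized dispersion of the lattice $\Lambda_2$ generated by $\begin{pmatrix}1&1+\sqrt2\\1&1-\sqrt2\end{pmatrix}$, and $$\frac{\operatorname{disp}(\Lambda_2)}{\det(\Lambda_2)}=\frac{3+2\sqrt2}{2\sqrt2}=2.06066\dots$$ (3) For every $n\ge 0$ its $(n+2)$-th smallest element is the normalized dispersion of the lattice generated by $\begin{pmatrix}1&-\Delta\\1&-\overline\Delta\end{pmatrix}$, where $\Delta=[\overline{2,\underbrace{1,\dots,1}_{2n},2}]$ and $\overline\Delta$ is the conjugate of the quadratic number $\Delta$. (For $n=0$ one has $\Delta=1+\sqrt2$.) (4) In (1), (2) and (3) the lattice is unique up to equivalence: an invertible matrix generates a lattice with the given normalized dispersion if and only if it is equivalent to the given matrix. (5) The values in (3) are strictly increasing in $n$ and converge to $$\frac{4+\sqrt5}{3}=2.07868\dots,$$ which is the normalized dispersion of the lattice generated by $\begin{pmatrix}1&-\Delta\\1&-\widetilde\Delta\end{pmatrix}$ with $\Delta=[2,\overline1]=\varphi^2$ and $-\widetilde\Delta=[0,2,\overline1]=\varphi^{-2}$. -/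

import Mathlib

open scoped ENNReal Matrix goldenRatio

noncomputable section

/-- The dispersion of a planar point set `P`: the supremum of the areas of the open axis-parallel
boxes `(a₀, b₀) × (a₁, b₁)` that contain no point of `P` (possibly `∞`). -/
def dispersion (P : Set (Fin 2 → ℝ)) : ℝ≥0∞ :=
  ⨆ (a : Fin 2 → ℝ) (b : Fin 2 → ℝ)
    (_ : Disjoint (Set.univ.pi fun i => Set.Ioo (a i) (b i)) P),
    MeasureTheory.volume (Set.univ.pi fun i => Set.Ioo (a i) (b i))

/-- The normalized dispersion `disp(Λ) / det(Λ)` of a planar lattice. -/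
def normalizedDispersion (L : Submodule ℤ (Fin 2 → ℝ)) : ℝ≥0∞ :=
  dispersion (L : Set (Fin 2 → ℝ)) / ENNReal.ofReal (ZLattice.covolume L)

/-- The set of the normalized dispersions of all lattices of full rank in the plane. -/
def normalizedDispersions : Set ℝ≥0∞ :=
  {v | ∃ (L : Submodule ℤ (Fin 2 → ℝ)) (_ : DiscreteTopology L) (_ : IsZLattice ℝ L),
    normalizedDispersion L = v}

/-- The subgroup of `ℝ²` generated by the columns of `A`. -/
def latticeOf (A : Matrix (Fin 2) (Fin 2) ℝ) : Submodule ℤ (Fin 2 → ℝ) :=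
  Submodule.span ℤ (Set.range A.col)

/-- Normalized box area equivalence of matrices: `B` arises from `A` by finitely many operations,
each a multiplication from the left by an invertible diagonal matrix or by the matrix exchanging the
coordinates, or a multiplication from the right by an element of `GL₂(ℤ)`. -/
inductive NBAEquiv (A : Matrix (Fin 2) (Fin 2) ℝ) : Matrix (Fin 2) (Fin 2) ℝ → Prop
  | refl : NBAEquiv A A
  | diag (a b : ℝ) (hab : a * b ≠ 0) {B : Matrix (Fin 2) (Fin 2) ℝ} (h : NBAEquiv A B) :
      NBAEquiv A (!![a, 0; 0, b] * B)
  | swap {B : Matrix (Fin 2) (Fin 2) ℝ} (h : NBAEquiv A B) : NBAEquiv A (!![0, 1; 1, 0] * B)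
  | right (U : GL (Fin 2) ℤ) {B : Matrix (Fin 2) (Fin 2) ℝ} (h : NBAEquiv A B) :
      NBAEquiv A (B * (U : Matrix (Fin 2) (Fin 2) ℤ).map (Int.cast : ℤ → ℝ))

/-- `v` is the `k`-th smallest element of `S` (counting from `k = 1`). -/
def IsKthSmallest (S : Set ℝ≥0∞) (k : ℕ) (v : ℝ≥0∞) : Prop :=
  v ∈ S ∧ {x ∈ S | x < v}.encard + 1 = k

/-- `x = [a 0, a 1, a 2, …]` is the (infinite) regular continued fraction expansion of `x`. -/
def HasContFracExpansion (x : ℝ) (a : ℕ → ℕ) : Prop :=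
  (GenContFract.of x).h = a 0 ∧
    ∀ k, (GenContFract.of x).s.get? k = some ⟨1, (a (k + 1) : ℝ)⟩

/-- The purely periodic sequence with period `2, 1, …, 1, 2`, with `2 * n` ones. -/
def bestCoeff (n k : ℕ) : ℕ :=
  if k % (2 * n + 2) = 0 ∨ k % (2 * n + 2) = 2 * n + 1 then 2 else 1

/-- `y` is the conjugate of the quadratic number `x`: for some rational `r`, `s` and some natural
number `d` that is not a square, `x = r + s √d` and `y = r - s √d`. -/
def IsQuadConj (x y : ℝ) : Prop :=
  ∃ (r s : ℚ) (d : ℕ), ¬ IsSquare d ∧ x = r + s * √(d : ℝ) ∧ y = r - s * √(d : ℝ)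

/-- The matrix `(1, -x; 1, -y)`, with columns `(1, 1)` and `(-x, -y)`. -/
def genMatrix (x y : ℝ) : Matrix (Fin 2) (Fin 2) ℝ := !![1, -x; 1, -y]

end

/-! A basis `(p, q)`, `(r, -t)` with `p, q, r, t > 0` spans the empty box `(0, p + r) × (-t, q)`,
and every empty box is at most as wide and as high as one of these. After scaling, the normalized
dispersion becomes a supremum of `boxArea ξ η` over bases `(1, 1)`, `(ξ, -η)` linked by subtractive
Euclidean moves. The lower bound is `IsFareyPair.boxArea_le`, the upper bound
`IsFareyClosed.exists_dominating_basis`.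

Those moves read off a two-sided continued fraction. Between two coefficients, with continued
fractions `x` to the left and `y` to the right, the area is at most 2. In the middle of a
coefficient 2 it is `2 + 1 / (2xt + x + t)`, where `y = 2 + 1/t`. The limit value is `2 + 1 / (6φ +
3)`. Below it, coefficients 3 and larger cannot occur (`LatticeCut.lt_three`), and every coefficient
2 satisfies `2xt + x + t > 6φ + 3`.

This inequality determines the word. A coefficient 2 has a neighbour 2. On both sides of `2, 2` the
tails exceed `φ`, so each starts with an even number of ones followed by a 2. The two numbers of
ones agree, because a longer run brings its tail too close to `φ` (`MidTwos.le_of_hasOnes`). So the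
word is constantly 1, or periodic with period `2, 1, …, 1, 2`; its tails are then fixed points of
contractions (`IsCutSystem.classification`).

`IsCutSystem` captures what is needed of a two-sided word. Applied to the cuts of an unknown lattice
it gives the classification; applied to explicit words it evaluates their dispersions
(`IsFareyPair.normalizedDispersion_le`). -/

/-! ### Empty boxes and bases with one column in each of two adjacent quadrants -/

/-- The open box `(x₁, x₂) × (y₁, y₂)` contains no integer combination of the columns of `A`. -/
def BoxFree (A : Matrix (Fin 2) (Fin 2) ℝ) (x₁ x₂ y₁ y₂ : ℝ) : Prop :=
  ∀ i j : ℤ, x₁ < i * A 0 0 + j * A 0 1 → i * A 0 0 + j * A 0 1 < x₂ →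
    y₁ < i * A 1 0 + j * A 1 1 → i * A 1 0 + j * A 1 1 < y₂ → False

/-- The normalized area of the empty box spanned by the basis `(1, 1)`, `(ξ, -η)`. -/
noncomputable def boxArea (ξ η : ℝ) : ℝ := (1 + ξ) * (1 + η) / (ξ + η)

lemma mem_latticeOf {A : Matrix (Fin 2) (Fin 2) ℝ} {x : Fin 2 → ℝ} :
    x ∈ latticeOf A ↔
      ∃ i j : ℤ, i * A 0 0 + j * A 0 1 = x 0 ∧ i * A 1 0 + j * A 1 1 = x 1 := by
  have h : Set.range A.col = {A.col 0, A.col 1} := by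
    ext v; simp [Fin.exists_fin_two, eq_comm]
  rw [latticeOf, h, Submodule.mem_span_pair]
  refine exists_congr fun i => exists_congr fun j => ?_
  rw [funext_iff, Fin.forall_fin_two]
  simp [Matrix.col]

/-- From any lattice point of a half-open vertical strip of width `p + r`, either adding `(p, q)` or
subtracting `(r, -t)` stays in the strip. Both moves go up, by at most `max q t`, so no window of
that height is jumped over. Since each move covers at least `m = min q t`, finitely many suffice,
downwards (`down`) as well as upwards (`up`). -/
lemma exists_lattice_point_in_strip {p q r t : ℝ} (hp : 0 < p) (hq : 0 < q) (hr : 0 < r)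
    (ht : 0 < t) (x y : ℝ) :
    ∃ i j : ℤ, x ≤ i * p + j * r ∧ i * p + j * r < x + p + r ∧
      y ≤ i * q - j * t ∧ i * q - j * t < y + max q t := by
  set m := min q t
  have hm0 : 0 < m := lt_min hq ht
  have hmq : m ≤ q := min_le_left _ _
  have hmt : m ≤ t := min_le_right _ _
  have hMq : q ≤ max q t := le_max_left _ _
  have hMt : t ≤ max q t := le_max_right _ _
  have down : ∀ n : ℕ, ∃ i j : ℤ, x ≤ i * p + j * r ∧ i * p + j * r < x + p + r ∧
      i * q - j * t ≤ ⌈x / p⌉ * q - n * m := by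
    intro n
    induction n with
    | zero =>
      refine ⟨⌈x / p⌉, 0, ?_, ?_, ?_⟩
      · have := (div_le_iff₀ hp).1 (Int.le_ceil (x / p))
        simpa using this
      · have h1 := Int.ceil_lt_add_one (x / p)
        have : (⌈x / p⌉ : ℝ) * p < (x / p + 1) * p := mul_lt_mul_of_pos_right h1 hp
        rw [add_mul, div_mul_cancel₀ _ hp.ne'] at this
        push_cast; linarith
      · simp
    | succ n ih =>
      obtain ⟨i, j, h1, h2, h3⟩ := ih
      by_cases hc : x + p ≤ i * p + j * r
      · exact ⟨i - 1, j, by push_cast; linarith, by push_cast; linarith, by push_cast; linarith⟩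
      · exact ⟨i, j + 1, by push_cast; linarith, by push_cast; linarith, by push_cast; linarith⟩
  have up : ∀ n : ℕ, ∀ i j : ℤ, x ≤ i * p + j * r → i * p + j * r < x + p + r →
      i * q - j * t < y → y ≤ i * q - j * t + n * m →
      ∃ i j : ℤ, x ≤ i * p + j * r ∧ i * p + j * r < x + p + r ∧
      y ≤ i * q - j * t ∧ i * q - j * t < y + max q t := by
    intro n
    induction n with
    | zero => intro i j _ _ h3 h4; simp at h4; linarith
    | succ n ih =>
      intro i j h1 h2 h3 h4
      push_cast at h4
      by_cases hc : i * p + j * r < x + r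
      · by_cases hy : y ≤ (i + 1 : ℤ) * q - j * t
        · refine ⟨i + 1, j, ?_, ?_, hy, ?_⟩ <;> push_cast <;> linarith
        · refine ih (i + 1) j ?_ ?_ (not_le.1 hy) ?_ <;> push_cast <;> linarith
      · by_cases hy : y ≤ i * q - (j - 1 : ℤ) * t
        · refine ⟨i, j - 1, ?_, ?_, hy, ?_⟩ <;> push_cast <;> linarith
        · refine ih i (j - 1) ?_ ?_ (not_le.1 hy) ?_ <;> push_cast <;> linarith
  obtain ⟨n, hn⟩ := exists_nat_gt ((⌈x / p⌉ * q - y) / m)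
  rw [div_lt_iff₀ hm0] at hn
  obtain ⟨i, j, h1, h2, h3⟩ := down n
  obtain ⟨k, hk⟩ := exists_nat_gt ((y - (i * q - j * t)) / m)
  rw [div_lt_iff₀ hm0] at hk
  exact up k i j h1 h2 (by linarith) (by linarith)

/-- Integer combinations of `(p, q)` and `(r, -t)` avoid the open box. -/
def TupleFree (p q r t x₁ x₂ y₁ y₂ : ℝ) : Prop :=
  ∀ i j : ℤ, x₁ < i * p + j * r → i * p + j * r < x₂ → y₁ < i * q - j * t →
    i * q - j * t < y₂ → False

lemma TupleFree.swap {p q r t x₁ x₂ y₁ y₂ : ℝ} (h : TupleFree p q r t x₁ x₂ y₁ y₂) :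
    TupleFree q p t r y₁ y₂ x₁ x₂ := by
  intro i j h1 h2 h3 h4
  refine h i (-j) ?_ ?_ ?_ ?_ <;> push_cast <;> linarith

lemma TupleFree.step_right {p q r t x₁ x₂ y₁ y₂ : ℝ} (h : TupleFree p q r t x₁ x₂ y₁ y₂) :
    TupleFree p q (p + r) (t - q) x₁ x₂ y₁ y₂ := by
  intro i j h1 h2 h3 h4
  refine h (i + j) j ?_ ?_ ?_ ?_ <;> push_cast <;> linarith

lemma TupleFree.step_left {p q r t x₁ x₂ y₁ y₂ : ℝ} (h : TupleFree p q r t x₁ x₂ y₁ y₂) :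
    TupleFree (p + r) (q - t) r t x₁ x₂ y₁ y₂ := by
  intro i j h1 h2 h3 h4
  refine h i (i + j) ?_ ?_ ?_ ?_ <;> push_cast <;> linarith

lemma TupleFree.height_le {p q r t x₁ x₂ y₁ y₂ : ℝ} (hp : 0 < p) (hq : 0 < q) (hr : 0 < r)
    (ht : 0 < t) (h : TupleFree p q r t x₁ x₂ y₁ y₂) (hw : p + r < x₂ - x₁) :
    y₂ - y₁ ≤ max q t := by
  by_contra! hc
  -- Centring the half-open window in the box puts it strictly inside the open box.
  obtain ⟨i, j, h1, h2, h3, h4⟩ := exists_lattice_point_in_strip hp hq hr ht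
    ((x₁ + x₂ - (p + r)) / 2) ((y₁ + y₂ - max q t) / 2)
  exact h i j (by linarith) (by linarith) (by linarith) (by linarith)

/-- A set of pairs `(ξ, η)` that is closed under the moves between neighbouring bases. -/
structure IsFareyClosed (P : ℝ → ℝ → Prop) : Prop where
  pos : ∀ {ξ η}, P ξ η → 0 < ξ
  ne_one : ∀ {ξ η}, P ξ η → η ≠ 1
  symm : ∀ {ξ η}, P ξ η → P η ξ
  inv : ∀ {ξ η}, P ξ η → P ξ⁻¹ η⁻¹
  step : ∀ {ξ η}, P ξ η → 1 < η → P (ξ + 1) (η - 1)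

/-- A box wider than `p + r` has height at most `max q t`. Subtracting the flatter column from the
steeper one gives a basis whose box has exactly this height and is wider by at least `m`. Repeating
this, the width of the given box is reached; the first basis that reaches it dominates in both
directions. -/
lemma IsFareyClosed.exists_large_basis {P : ℝ → ℝ → Prop} (hP : IsFareyClosed P)
    {x₁ x₂ y₁ y₂ m : ℝ} (n : ℕ) : ∀ {p q r t : ℝ}, 0 < p → 0 < q → 0 < r → 0 < t →
      m ≤ p → m ≤ r → P (r / p) (t / q) → TupleFree p q r t x₁ x₂ y₁ y₂ →
      p + r < x₂ - x₁ → x₂ - x₁ < p + r + n * m →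
      ∃ p' q' r' t' : ℝ, 0 < p' ∧ 0 < q' ∧ 0 < r' ∧ 0 < t' ∧ P (r' / p') (t' / q') ∧
        x₂ - x₁ ≤ p' + r' ∧ y₂ - y₁ ≤ q' + t' ∧ p' * t' + q' * r' = p * t + q * r := by
  induction n with
  | zero => intro p q r t _ _ _ _ _ _ _ _ h1 h2; simp at h2; linarith
  | succ n ih =>
    intro p q r t hp hq hr ht hmp hmr hPt hfree hw hn
    push_cast at hn
    have hh := hfree.height_le hp hq hr ht hw
    rcases lt_trichotomy q t with hlt | heq | hgt
    · have hP' : P ((p + r) / p) ((t - q) / q) := by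
        have := hP.step hPt ((one_lt_div hq).2 hlt)
        convert this using 1 <;> (field_simp; try ring)
      rw [max_eq_right hlt.le] at hh
      rcases lt_or_ge (p + (p + r)) (x₂ - x₁) with h | h
      · obtain ⟨p', q', r', t', h1, h2, h3, h4, h5, h6, h7, h8⟩ :=
          ih hp hq (by linarith) (sub_pos.2 hlt) hmp (by linarith) hP' hfree.step_right h
            (by linarith)
        exact ⟨p', q', r', t', h1, h2, h3, h4, h5, h6, h7, by rw [h8]; ring⟩
      · exact ⟨p, q, p + r, t - q, hp, hq, by linarith, by linarith, hP', h, by linarith, by ring⟩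
    -- Equal heights would produce a lattice vector on an axis; `ne_one` excludes this.
    · exact absurd (by rw [heq, div_self ht.ne']) (hP.ne_one hPt)
    · have hP' : P (r / (p + r)) (t / (q - t)) := by
        have h1 := hP.inv hPt
        have h2 := hP.inv (hP.step h1 (by rw [inv_div]; exact (one_lt_div ht).2 hgt))
        have : q - t ≠ 0 := by linarith
        have : p + r ≠ 0 := by linarith
        convert h2 using 1
        · field_simp
        · have : q / t - 1 ≠ 0 := by
            rw [div_sub_one ht.ne']; exact div_ne_zero ‹_› ht.ne'
          rw [inv_div, div_sub_one ht.ne', inv_div]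
      rw [max_eq_left hgt.le] at hh
      rcases lt_or_ge ((p + r) + r) (x₂ - x₁) with h | h
      · obtain ⟨p', q', r', t', h1, h2, h3, h4, h5, h6, h7, h8⟩ :=
          ih (by linarith) (sub_pos.2 hgt) hr ht (by linarith) hmr hP' hfree.step_left h
            (by linarith)
        exact ⟨p', q', r', t', h1, h2, h3, h4, h5, h6, h7, by rw [h8]; ring⟩
      · exact ⟨p + r, q - t, r, t, by linarith, by linarith, hr, ht, hP', h, by linarith, by ring⟩

/-- A box that is too high becomes one that is too wide when the coordinates are exchanged; one that
is neither is dominated by the initial basis. -/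
lemma IsFareyClosed.exists_dominating_basis {P : ℝ → ℝ → Prop} (hP : IsFareyClosed P)
    {x₁ x₂ y₁ y₂ p q r t : ℝ} (hp : 0 < p) (hq : 0 < q) (hr : 0 < r) (ht : 0 < t)
    (hPt : P (r / p) (t / q)) (hfree : TupleFree p q r t x₁ x₂ y₁ y₂) :
      ∃ p' q' r' t' : ℝ, 0 < p' ∧ 0 < q' ∧ 0 < r' ∧ 0 < t' ∧ P (r' / p') (t' / q') ∧
        x₂ - x₁ ≤ p' + r' ∧ y₂ - y₁ ≤ q' + t' ∧ p' * t' + q' * r' = p * t + q * r := by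
  by_cases hw : p + r < x₂ - x₁
  · have hm : 0 < min p r := lt_min hp hr
    obtain ⟨n, hn⟩ := exists_nat_gt ((x₂ - x₁ - (p + r)) / min p r)
    rw [div_lt_iff₀ hm] at hn
    exact hP.exists_large_basis n hp hq hr ht (min_le_left _ _) (min_le_right _ _) hPt hfree hw
      (by linarith)
  by_cases hh : q + t < y₂ - y₁
  · have hm : 0 < min q t := lt_min hq ht
    obtain ⟨n, hn⟩ := exists_nat_gt ((y₂ - y₁ - (q + t)) / min q t)
    rw [div_lt_iff₀ hm] at hn
    obtain ⟨q', p', t', r', h1, h2, h3, h4, h5, h6, h7, h8⟩ :=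
      hP.exists_large_basis n hq hp ht hr (min_le_left _ _) (min_le_right _ _) (hP.symm hPt)
        hfree.swap hh (by linarith)
    exact ⟨p', q', r', t', h2, h1, h4, h3, hP.symm h5, h7, h6, by linarith⟩
  · exact ⟨p, q, r, t, hp, hq, hr, ht, hPt, not_lt.1 hw, not_lt.1 hh, rfl⟩

lemma IsFareyClosed.area_le {P : ℝ → ℝ → Prop} (hP : IsFareyClosed P) {V : ℝ}
    (hV : ∀ ξ η, P ξ η → boxArea ξ η ≤ V)
    {x₁ x₂ y₁ y₂ ξ η : ℝ} (hPt : P ξ η) (hy : y₁ < y₂)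
    (hfree : TupleFree 1 1 ξ η x₁ x₂ y₁ y₂) :
    (x₂ - x₁) * (y₂ - y₁) ≤ V * (ξ + η) := by
  have hξ := hP.pos hPt
  have hη := hP.pos (hP.symm hPt)
  obtain ⟨p, q, r, t, hp, hq, hr, ht, h5, h6, h7, h8⟩ :=
    hP.exists_dominating_basis one_pos one_pos hξ hη (by simpa using hPt) hfree
  have h9 := hV _ _ h5
  have hd : 0 < p * t + q * r := by positivity
  have h10 : boxArea (r / p) (t / q) = (p + r) * (q + t) / (p * t + q * r) := by
    rw [boxArea]; field_simp; ring
  rw [h10, div_le_iff₀ hd, h8] at h9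
  calc (x₂ - x₁) * (y₂ - y₁) ≤ (p + r) * (q + t) := by
        apply mul_le_mul h6 h7 <;> linarith
    _ ≤ _ := by linarith

/-! ### Dispersion in terms of generating matrices, and its invariance -/

open MeasureTheory

lemma isZLattice_latticeOf {A : Matrix (Fin 2) (Fin 2) ℝ} (hA : A.det ≠ 0) :
    ∃ (_ : DiscreteTopology (latticeOf A)) (_ : IsZLattice ℝ (latticeOf A)),
      ZLattice.covolume (latticeOf A) = |A.det| := by
  have hli : LinearIndependent ℝ A.col :=
    Matrix.linearIndependent_cols_iff_isUnit.2
      ((Matrix.isUnit_iff_isUnit_det A).2 (isUnit_iff_ne_zero.2 hA))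
  let b := basisOfLinearIndependentOfCardEqFinrank hli (by simp)
  have hb : ⇑b = A.col := coe_basisOfLinearIndependentOfCardEqFinrank hli (by simp)
  have hL : latticeOf A = Submodule.span ℤ (Set.range b) := by rw [hb, latticeOf]
  rw [hL]
  refine ⟨inferInstance, inferInstance, ?_⟩
  rw [ZLattice.covolume_eq_det _ (b.restrictScalars ℤ)]
  have : (Matrix.of (Subtype.val ∘ ⇑(b.restrictScalars ℤ)) : Matrix (Fin 2) (Fin 2) ℝ) = Aᵀ := by
    ext i j
    simp [hb, Matrix.col]
  rw [this, Matrix.det_transpose]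

lemma exists_latticeOf_eq (L : Submodule ℤ (Fin 2 → ℝ)) [DiscreteTopology L] [IsZLattice ℝ L] :
    ∃ A : Matrix (Fin 2) (Fin 2) ℝ, A.det ≠ 0 ∧ L = latticeOf A := by
  have hr : Module.finrank ℤ L = 2 := by rw [ZLattice.rank ℝ L]; simp
  let b : Module.Basis (Fin 2) ℤ L := Module.finBasisOfFinrankEq ℤ L hr
  let B := b.ofZLatticeBasis ℝ L
  refine ⟨(Matrix.of fun i => (b i : Fin 2 → ℝ))ᵀ, ?_, ?_⟩
  · have : LinearIndependent ℝ (fun i => (b i : Fin 2 → ℝ)) := by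
      have := B.linearIndependent
      rwa [show ⇑B = fun i => (b i : Fin 2 → ℝ) by ext i; simp [B]] at this
    rw [Matrix.det_transpose, ← isUnit_iff_ne_zero, ← Matrix.isUnit_iff_isUnit_det]
    exact Matrix.linearIndependent_rows_iff_isUnit.1 this
  · have h2 := b.ofZLatticeBasis_span ℝ L
    refine h2.symm.trans ?_
    rw [latticeOf]
    congr 2
    ext i j; simp [Matrix.col]

lemma volume_box (a b : Fin 2 → ℝ) :
    volume (Set.univ.pi fun i => Set.Ioo (a i) (b i)) =
      ENNReal.ofReal (b 0 - a 0) * ENNReal.ofReal (b 1 - a 1) := by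
  rw [Real.volume_pi_Ioo, Fin.prod_univ_two]

lemma disjoint_latticeOf_iff {A : Matrix (Fin 2) (Fin 2) ℝ} {a b : Fin 2 → ℝ} :
    Disjoint (Set.univ.pi fun i => Set.Ioo (a i) (b i)) (latticeOf A : Set (Fin 2 → ℝ)) ↔
      BoxFree A (a 0) (b 0) (a 1) (b 1) := by
  rw [Set.disjoint_right]
  constructor
  · intro h i j h1 h2 h3 h4
    refine h (a := ![i * A 0 0 + j * A 0 1, i * A 1 0 + j * A 1 1])
      (mem_latticeOf.2 ⟨i, j, by simp, by simp⟩) ?_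
    rw [Set.mem_univ_pi, Fin.forall_fin_two]
    exact ⟨⟨h1, h2⟩, ⟨h3, h4⟩⟩
  · intro h x hx hx'
    obtain ⟨i, j, h0, h1⟩ := mem_latticeOf.1 hx
    rw [Set.mem_univ_pi, Fin.forall_fin_two] at hx'
    obtain ⟨⟨h2, h3⟩, h4, h5⟩ := hx'
    exact h i j (by rwa [h0]) (by rwa [h0]) (by rwa [h1]) (by rwa [h1])

lemma normalizedDispersion_le_iff {A : Matrix (Fin 2) (Fin 2) ℝ} (hA : A.det ≠ 0) {c : ℝ≥0∞} :
    normalizedDispersion (latticeOf A) ≤ c ↔ ∀ x₁ x₂ y₁ y₂ : ℝ, x₁ < x₂ → y₁ < y₂ →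
      BoxFree A x₁ x₂ y₁ y₂ → ENNReal.ofReal ((x₂ - x₁) * (y₂ - y₁) / |A.det|) ≤ c := by
  obtain ⟨_, _, hcov⟩ := isZLattice_latticeOf hA
  have hd : 0 < |A.det| := abs_pos.2 hA
  rw [normalizedDispersion, hcov,
    ENNReal.div_le_iff (by simpa using hA) ENNReal.ofReal_ne_top, dispersion]
  simp only [iSup_le_iff, volume_box, disjoint_latticeOf_iff]
  have key : ∀ s : ℝ, ENNReal.ofReal (s / |A.det|) ≤ c ↔
      ENNReal.ofReal s ≤ c * ENNReal.ofReal |A.det| := by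
    intro s
    rw [ENNReal.ofReal_div_of_pos hd,
      ENNReal.div_le_iff (by simpa using hA) ENNReal.ofReal_ne_top]
  constructor
  · intro h x₁ x₂ y₁ y₂ hx hy hfree
    rw [key, ENNReal.ofReal_mul (by linarith)]
    exact h ![x₁, y₁] ![x₂, y₂] hfree
  · intro h a b hfree
    rcases le_or_gt (b 0) (a 0) with h0 | h0
    · rw [ENNReal.ofReal_of_nonpos (by linarith), zero_mul]; exact zero_le
    rcases le_or_gt (b 1) (a 1) with h1 | h1
    · rw [ENNReal.ofReal_of_nonpos (p := b 1 - a 1) (by linarith), mul_zero]; exact zero_le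
    rw [← ENNReal.ofReal_mul (by linarith), ← key]
    exact h _ _ _ _ h0 h1 hfree

lemma le_normalizedDispersion {A : Matrix (Fin 2) (Fin 2) ℝ} (hA : A.det ≠ 0)
    {x₁ x₂ y₁ y₂ : ℝ} (hx : x₁ < x₂) (hy : y₁ < y₂) (h : BoxFree A x₁ x₂ y₁ y₂) :
    ENNReal.ofReal ((x₂ - x₁) * (y₂ - y₁) / |A.det|) ≤ normalizedDispersion (latticeOf A) :=
  (normalizedDispersion_le_iff hA).1 le_rfl _ _ _ _ hx hy h

lemma normalizedDispersion_swap_le {A : Matrix (Fin 2) (Fin 2) ℝ} (hA : A.det ≠ 0) :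
    normalizedDispersion (latticeOf (!![0, 1; 1, 0] * A)) ≤ normalizedDispersion (latticeOf A) := by
  have hd : |(!![0, 1; 1, 0] * A).det| = |A.det| := by
    rw [Matrix.det_mul, Matrix.det_fin_two_of]; simp
  rw [normalizedDispersion_le_iff (abs_ne_zero.1 (by rw [hd]; exact abs_ne_zero.2 hA)), hd]
  intro x₁ x₂ y₁ y₂ hx hy hfree
  rw [mul_comm]
  refine le_normalizedDispersion hA hy hx fun i j h1 h2 h3 h4 => hfree i j ?_ ?_ ?_ ?_ <;>
    simpa [Matrix.mul_apply, Fin.sum_univ_two]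

lemma normalizedDispersion_diag_le {A : Matrix (Fin 2) (Fin 2) ℝ} (hA : A.det ≠ 0) {a b : ℝ}
    (hab : a * b ≠ 0) :
    normalizedDispersion (latticeOf (!![a, 0; 0, b] * A)) ≤
      normalizedDispersion (latticeOf A) := by
  have hd : |(!![a, 0; 0, b] * A).det| = |a| * |b| * |A.det| := by
    rw [Matrix.det_mul, Matrix.det_fin_two_of]; simp [abs_mul]
  have ha : a ≠ 0 := left_ne_zero_of_mul hab
  have hb : b ≠ 0 := right_ne_zero_of_mul hab
  have ha' := abs_pos.2 ha
  have hb' := abs_pos.2 hb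
  have hA' := abs_pos.2 hA
  rw [normalizedDispersion_le_iff (abs_ne_zero.1 (by rw [hd]; positivity)), hd]
  intro x₁ x₂ y₁ y₂ hx hy hfree
  have scale : ∀ c : ℝ, c ≠ 0 → ∀ z₁ z₂ : ℝ, z₁ < z₂ → ∃ w₁ w₂ : ℝ, w₁ < w₂ ∧
      w₂ - w₁ = (z₂ - z₁) / |c| ∧ ∀ s, w₁ < s → s < w₂ → z₁ < c * s ∧ c * s < z₂ := by
    intro c hc z₁ z₂ hz
    rcases lt_or_gt_of_ne hc with h | h
    · refine ⟨z₂ / c, z₁ / c, (div_lt_div_right_of_neg h).2 hz, ?_, fun s h1 h2 => ⟨?_, ?_⟩⟩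
      · rw [abs_of_neg h]; field_simp; ring
      · rw [lt_div_iff_of_neg h] at h2; linarith
      · rw [div_lt_iff_of_neg h] at h1; linarith
    · refine ⟨z₁ / c, z₂ / c, (div_lt_div_iff_of_pos_right h).2 hz, ?_, fun s h1 h2 => ⟨?_, ?_⟩⟩
      · rw [abs_of_pos h]; ring
      · rw [div_lt_iff₀ h] at h1; linarith
      · rw [lt_div_iff₀ h] at h2; linarith
  obtain ⟨w₁, w₂, hw, hwd, hws⟩ := scale a ha x₁ x₂ hx
  obtain ⟨u₁, u₂, hu, hud, hus⟩ := scale b hb y₁ y₂ hy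
  have : (x₂ - x₁) * (y₂ - y₁) / (|a| * |b| * |A.det|) = (w₂ - w₁) * (u₂ - u₁) / |A.det| := by
    rw [hwd, hud]; field_simp
  rw [this]
  refine le_normalizedDispersion hA hw hu fun i j h1 h2 h3 h4 => ?_
  obtain ⟨k1, k2⟩ := hws _ h1 h2
  obtain ⟨k3, k4⟩ := hus _ h3 h4
  refine hfree i j ?_ ?_ ?_ ?_ <;> simp [Matrix.mul_apply, Fin.sum_univ_two] <;> linarith

lemma latticeOf_mul_le (A X : Matrix (Fin 2) (Fin 2) ℝ) (Y : Matrix (Fin 2) (Fin 2) ℤ)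
    (h : X = A * Y.map (Int.cast : ℤ → ℝ)) : latticeOf X ≤ latticeOf A := by
  intro x hx
  obtain ⟨i, j, h0, h1⟩ := mem_latticeOf.1 hx
  refine mem_latticeOf.2 ⟨i * Y 0 0 + j * Y 0 1, i * Y 1 0 + j * Y 1 1, ?_, ?_⟩
  · rw [← h0, h]; simp [Matrix.mul_apply, Fin.sum_univ_two]; ring
  · rw [← h1, h]; simp [Matrix.mul_apply, Fin.sum_univ_two]; ring

lemma map_mul_map_inv (U : GL (Fin 2) ℤ) :
    (U : Matrix (Fin 2) (Fin 2) ℤ).map (Int.cast : ℤ → ℝ) *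
      ((U⁻¹ : GL (Fin 2) ℤ) : Matrix (Fin 2) (Fin 2) ℤ).map (Int.cast : ℤ → ℝ) = 1 := by
  have h := congrArg (fun N : Matrix (Fin 2) (Fin 2) ℤ => N.map (Int.castRingHom ℝ))
    (Units.mul_inv U)
  simp only [Matrix.map_mul] at h
  exact h.trans (Matrix.map_one _ (map_zero _) (map_one _))

lemma latticeOf_mul (A : Matrix (Fin 2) (Fin 2) ℝ) (U : GL (Fin 2) ℤ) :
    latticeOf (A * (U : Matrix (Fin 2) (Fin 2) ℤ).map (Int.cast : ℤ → ℝ)) = latticeOf A := by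
  refine le_antisymm (latticeOf_mul_le _ _ _ rfl) (latticeOf_mul_le _ _ (U⁻¹ : GL (Fin 2) ℤ).val ?_)
  rw [Matrix.mul_assoc, map_mul_map_inv, Matrix.mul_one]

/-- Each operation has an inverse of the same kind, so the one-sided estimates for diagonal matrices
and the exchange give equalities; right multiplication does not change the lattice. -/
lemma NBAEquiv.invariant {A B : Matrix (Fin 2) (Fin 2) ℝ} (hA : A.det ≠ 0) (h : NBAEquiv A B) :
    B.det ≠ 0 ∧ normalizedDispersion (latticeOf B) = normalizedDispersion (latticeOf A) := by
  induction h with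
  | refl => exact ⟨hA, rfl⟩
  | @diag a b hab B _ ih =>
    have hd : (!![a, 0; 0, b] * B).det ≠ 0 := by
      rw [Matrix.det_mul, Matrix.det_fin_two_of]; simpa using ⟨by simpa using hab, ih.1⟩
    refine ⟨hd, (le_antisymm (normalizedDispersion_diag_le ih.1 hab) ?_).trans ih.2⟩
    have ha : a ≠ 0 := left_ne_zero_of_mul hab
    have hb : b ≠ 0 := right_ne_zero_of_mul hab
    have := normalizedDispersion_diag_le hd (a := a⁻¹) (b := b⁻¹) (by simp [ha, hb])
    rw [← Matrix.mul_assoc] at this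
    simpa [ha, hb, Matrix.mul_fin_two, ← Matrix.one_fin_two] using this
  | @swap B _ ih =>
    have hd : (!![0, 1; 1, 0] * B).det ≠ 0 := by
      rw [Matrix.det_mul, Matrix.det_fin_two_of]; simpa using ih.1
    refine ⟨hd, (le_antisymm (normalizedDispersion_swap_le ih.1) ?_).trans ih.2⟩
    have := normalizedDispersion_swap_le hd
    rw [← Matrix.mul_assoc] at this
    simpa [Matrix.mul_fin_two, ← Matrix.one_fin_two] using this
  | @right U B _ ih =>
    refine ⟨?_, by rw [latticeOf_mul, ih.2]⟩
    rw [Matrix.det_mul]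
    refine mul_ne_zero ih.1 fun h0 => ?_
    have := congrArg Matrix.det (map_mul_map_inv U)
    rw [Matrix.det_mul, h0] at this
    simp at this

lemma NBAEquiv.of_mul {A B C : Matrix (Fin 2) (Fin 2) ℝ} (h : NBAEquiv A B)
    (X : Matrix (Fin 2) (Fin 2) ℤ) (hX : IsUnit X.det)
    (hC : C = B * X.map (Int.cast : ℤ → ℝ)) : NBAEquiv A C := by
  obtain ⟨U, hU⟩ := (Matrix.isUnit_iff_isUnit_det X).2 hX
  rw [hC, ← hU]
  exact h.right U

/-! ### Lattices of finite dispersion have no points on the axes -/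

/-- The relation makes all values `i a + j b` integer multiples of a single number, so the positive
ones stay away from 0. -/
lemma exists_gap_of_dependent {a b : ℝ} {m n : ℤ} (hmn : m ≠ 0 ∨ n ≠ 0)
    (h : m * a + n * b = 0) :
    ∃ ε : ℝ, 0 < ε ∧ ∀ i j : ℤ, 0 < i * a + j * b → i * a + j * b < ε → False := by
  wlog hm : m ≠ 0 generalizing a b m n
  · obtain ⟨ε, hε, hε'⟩ := this hmn.symm (by rw [add_comm]; exact h) (by tauto)
    exact ⟨ε, hε, fun i j h1 h2 => hε' j i (by linarith) (by linarith)⟩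
  have hm' : (m : ℝ) ≠ 0 := by exact_mod_cast hm
  by_cases hb : b = 0
  · have ha : a = 0 := by simpa [hb, hm'] using h
    exact ⟨1, one_pos, fun i j h1 _ => by simp [ha, hb] at h1⟩
  have hc : 0 < |b / m| := abs_pos.2 (div_ne_zero hb hm')
  refine ⟨|b / m|, hc, fun i j h1 h2 => ?_⟩
  have key : i * a + j * b = ((j * m - i * n : ℤ) : ℝ) * (b / m) := by
    have : a = -(n * b) / m := by field_simp; linarith
    rw [this]; push_cast; field_simp; ring
  rw [key] at h1 h2
  rw [← abs_of_pos h1, abs_mul] at h2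
  have h3 : |((j * m - i * n : ℤ) : ℝ)| < 1 := by
    by_contra! h4
    nlinarith
  rw [← Int.cast_abs] at h3
  have h4 : |j * m - i * n| < 1 := by exact_mod_cast h3
  rw [Int.abs_lt_one_iff.1 h4] at h1
  simp at h1

/-- The gap is an empty horizontal strip, which contains empty boxes of arbitrary length. -/
lemma normalizedDispersion_eq_top {B : Matrix (Fin 2) (Fin 2) ℝ} (hB : B.det ≠ 0) {m n : ℤ}
    (hmn : m ≠ 0 ∨ n ≠ 0) (h : m * B 1 0 + n * B 1 1 = 0) :
    normalizedDispersion (latticeOf B) = ⊤ := by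
  obtain ⟨ε, hε, hfree⟩ := exists_gap_of_dependent hmn h
  have hd : 0 < |B.det| := abs_pos.2 hB
  refine ENNReal.eq_top_of_forall_nnreal_le fun r => ?_
  have hK : 0 < ((r : ℝ) + 1) * |B.det| / ε := by positivity
  refine le_trans ?_ (le_normalizedDispersion hB hK hε fun i j _ _ => hfree i j)
  rw [← ENNReal.ofReal_coe_nnreal]
  apply ENNReal.ofReal_le_ofReal
  rw [sub_zero, sub_zero, div_mul_cancel₀ _ hε.ne', mul_div_cancel_right₀ _ hd.ne']
  linarith

lemma NBAEquiv.row_ne_zero {A B : Matrix (Fin 2) (Fin 2) ℝ} (hA : A.det ≠ 0)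
    (htop : normalizedDispersion (latticeOf A) ≠ ⊤) (h : NBAEquiv A B) (k : Fin 2) {m n : ℤ}
    (hmn : m ≠ 0 ∨ n ≠ 0) : m * B k 0 + n * B k 1 ≠ 0 := by
  intro h0
  fin_cases k
  · obtain ⟨h1, h2⟩ := h.swap.invariant hA
    refine htop (h2.symm.trans (normalizedDispersion_eq_top h1 hmn ?_))
    simpa [Matrix.mul_apply, Fin.sum_univ_two] using h0
  · obtain ⟨h1, h2⟩ := h.invariant hA
    exact htop (h2.symm.trans (normalizedDispersion_eq_top h1 hmn h0))

/-! ### Reduction to the columns `(1, 1)` and `(ξ, -η)` -/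

/-- After equivalence, `A` has the columns `(1, 1)` and `(ξ, -η)` with `ξ, η > 0`. -/
structure IsFareyPair (A : Matrix (Fin 2) (Fin 2) ℝ) (ξ η : ℝ) : Prop where
  pos_left : 0 < ξ
  pos_right : 0 < η
  equiv : NBAEquiv A !![1, ξ; 1, -η]

namespace NBAEquiv

variable {A : Matrix (Fin 2) (Fin 2) ℝ} {p q r t : ℝ}

lemma neg_col (h : NBAEquiv A !![p, r; q, t]) : NBAEquiv A !![p, -r; q, -t] :=
  h.of_mul !![1, 0; 0, -1] (by simp [Matrix.det_fin_two_of]) (by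
    ext i j; fin_cases i <;> fin_cases j <;> simp [Matrix.mul_apply, Fin.sum_univ_two])

lemma swap_col (h : NBAEquiv A !![p, r; q, t]) : NBAEquiv A !![r, p; t, q] :=
  h.of_mul !![0, 1; 1, 0] (by simp [Matrix.det_fin_two_of]) (by
    ext i j; fin_cases i <;> fin_cases j <;> simp [Matrix.mul_apply, Fin.sum_univ_two])

lemma add_col (h : NBAEquiv A !![p, r; q, t]) : NBAEquiv A !![p, p + r; q, q + t] :=
  h.of_mul !![1, 1; 0, 1] (by simp [Matrix.det_fin_two_of]) (by
    ext i j; fin_cases i <;> fin_cases j <;> simp [Matrix.mul_apply, Fin.sum_univ_two])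

lemma sub_col (h : NBAEquiv A !![p, r; q, t]) : NBAEquiv A !![p, r - p; q, t - q] :=
  h.of_mul !![1, -1; 0, 1] (by simp [Matrix.det_fin_two_of]) (by
    ext i j; fin_cases i <;> fin_cases j <;> simp [Matrix.mul_apply, Fin.sum_univ_two] <;> ring)

lemma scale_rows {a b : ℝ} (hab : a * b ≠ 0) (h : NBAEquiv A !![p, r; q, t]) :
    NBAEquiv A !![a * p, a * r; b * q, b * t] := by
  have := h.diag a b hab
  rwa [show !![a, 0; 0, b] * !![p, r; q, t] = !![a * p, a * r; b * q, b * t] by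
    ext i j; fin_cases i <;> fin_cases j <;> simp [Matrix.mul_apply, Fin.sum_univ_two]] at this

lemma swap_rows (h : NBAEquiv A !![p, r; q, t]) : NBAEquiv A !![q, t; p, r] := by
  have := h.swap
  rwa [show !![0, 1; 1, 0] * !![p, r; q, t] = !![q, t; p, r] by
    ext i j; fin_cases i <;> fin_cases j <;> simp [Matrix.mul_apply, Fin.sum_univ_two]] at this

lemma normalize (hp : p ≠ 0) (hq : q ≠ 0) (h : NBAEquiv A !![p, r; q, t]) :
    NBAEquiv A !![1, r / p; 1, t / q] := by
  have := h.scale_rows (a := p⁻¹) (b := q⁻¹) (by simp [hp, hq])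
  rwa [inv_mul_cancel₀ hp, inv_mul_cancel₀ hq, inv_mul_eq_div, inv_mul_eq_div] at this

lemma exists_isFareyPair_of_neg (h : NBAEquiv A !![p, r; q, t]) (hneg : p * q * (r * t) < 0) :
    ∃ ξ η, IsFareyPair A ξ η := by
  have hp : p ≠ 0 := by rintro rfl; simp at hneg
  have hq : q ≠ 0 := by rintro rfl; simp at hneg
  have h1 := h.normalize hp hq
  have h2 : (r / p) * (t / q) < 0 := by
    have : (r / p) * (t / q) = p * q * (r * t) / (p * q) ^ 2 := by field_simp
    rw [this]
    exact div_neg_of_neg_of_pos hneg (by positivity)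
  rcases mul_neg_iff.1 h2 with ⟨h3, h4⟩ | ⟨h3, h4⟩
  · exact ⟨r / p, -(t / q), h3, neg_pos.2 h4, by simpa using h1⟩
  · exact ⟨-(r / p), t / q, neg_pos.2 h3, h4, h1.neg_col⟩

/-- Simultaneous subtractive Euclidean algorithm in both rows. If the rows disagree on which column
is larger, the difference has mixed signs and the reduction is finished. Otherwise subtracting keeps
all entries positive and the determinant fixed, and lowers the sum of the entries by at least `d /
K`, which can happen only finitely often. -/
lemma exists_isFareyPair_of_pos (hA : A.det ≠ 0)
    (htop : normalizedDispersion (latticeOf A) ≠ ⊤) {d K : ℝ} (hK : 0 < K) (n : ℕ) :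
    ∀ {p q r t : ℝ}, 0 < p → 0 < q → 0 < r → 0 < t → p ≤ K → q ≤ K → r ≤ K → t ≤ K →
      |p * t - q * r| = d → p + q + r + t < n * (d / K) → NBAEquiv A !![p, r; q, t] →
      ∃ ξ η, IsFareyPair A ξ η := by
  induction n with
  | zero => intro p q r t _ _ _ _ _ _ _ _ _ h; simp at h; linarith
  | succ n ih =>
    intro p q r t hp hq hr ht hpK hqK hrK htK hdet hn h
    push_cast at hn
    have h0 := h.row_ne_zero hA htop 0 (m := -1) (n := 1) (by simp)
    have h1 := h.row_ne_zero hA htop 1 (m := -1) (n := 1) (by simp)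
    replace h0 : r - p ≠ 0 := fun e => h0 (by simp; linarith)
    replace h1 : t - q ≠ 0 := fun e => h1 (by simp; linarith)
    -- With all entries at most `K`, the determinant is at most `K (p + q)`, so no column is too
    -- small.
    have hpq : d / K ≤ p + q := by
      rw [div_le_iff₀ hK, ← hdet, abs_le]; constructor <;> nlinarith
    have hrt : d / K ≤ r + t := by
      rw [div_le_iff₀ hK, ← hdet, abs_le]; constructor <;> nlinarith
    rcases lt_or_gt_of_ne h0 with h2 | h2 <;> rcases lt_or_gt_of_ne h1 with h3 | h3
    · refine ih (p := p - r) (q := q - t) (r := r) (t := t) (by linarith) (by linarith) hr ht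
        (by linarith) (by linarith) hrK htK ?_ (by linarith) h.swap_col.sub_col.swap_col
      rw [← hdet]; congr 1; ring
    · exact h.sub_col.exists_isFareyPair_of_neg
        (mul_neg_of_pos_of_neg (by positivity) (mul_neg_of_neg_of_pos h2 h3))
    · exact h.sub_col.exists_isFareyPair_of_neg
        (mul_neg_of_pos_of_neg (by positivity) (mul_neg_of_pos_of_neg h2 h3))
    · refine ih (p := p) (q := q) (r := r - p) (t := t - q) hp hq h2 h3 hpK hqK
        (by linarith) (by linarith) ?_ (by linarith) h.sub_col
      rw [← hdet]; congr 1; ring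

lemma exists_isFareyPair_of_pos_ratio (hA : A.det ≠ 0)
    (htop : normalizedDispersion (latticeOf A) ≠ ⊤) {a b : ℝ} (ha : 0 < a) (hb : 0 < b)
    (h : NBAEquiv A !![1, a; 1, b]) : ∃ ξ η, IsFareyPair A ξ η := by
  have hdet := (h.invariant hA).1
  rw [Matrix.det_fin_two_of] at hdet
  have hd : 0 < |1 * b - 1 * a| := abs_pos.2 (by intro e; apply hdet; linarith)
  have hK : 0 < 1 + a + b := by positivity
  obtain ⟨n, hn⟩ := exists_nat_gt ((1 + 1 + a + b) / (|1 * b - 1 * a| / (1 + a + b)))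
  rw [div_lt_iff₀ (by positivity)] at hn
  exact exists_isFareyPair_of_pos hA htop hK n one_pos one_pos ha hb (by linarith)
    (by linarith) (by linarith) (by linarith) rfl hn h

end NBAEquiv

lemma exists_isFareyPair {A : Matrix (Fin 2) (Fin 2) ℝ} (hA : A.det ≠ 0)
    (htop : normalizedDispersion (latticeOf A) ≠ ⊤) : ∃ ξ η, IsFareyPair A ξ η := by
  have h : NBAEquiv A !![A 0 0, A 0 1; A 1 0, A 1 1] := by
    rw [← Matrix.eta_fin_two]; exact .refl
  have hp : A 0 0 ≠ 0 := by
    simpa using h.row_ne_zero hA htop 0 (m := 1) (n := 0) (by simp)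
  have hr : A 0 1 ≠ 0 := by
    simpa using h.row_ne_zero hA htop 0 (m := 0) (n := 1) (by simp)
  have hq : A 1 0 ≠ 0 := by
    simpa using h.row_ne_zero hA htop 1 (m := 1) (n := 0) (by simp)
  have ht : A 1 1 ≠ 0 := by
    simpa using h.row_ne_zero hA htop 1 (m := 0) (n := 1) (by simp)
  have h1 := h.normalize hp hq
  rcases lt_or_gt_of_ne (div_ne_zero hr hp) with h2 | h2 <;>
    rcases lt_or_gt_of_ne (div_ne_zero ht hq) with h3 | h3
  · exact NBAEquiv.exists_isFareyPair_of_pos_ratio hA htop (neg_pos.2 h2) (neg_pos.2 h3) h1.neg_col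
  · exact h1.exists_isFareyPair_of_neg (by simpa using mul_neg_of_neg_of_pos h2 h3)
  · exact h1.exists_isFareyPair_of_neg (by simpa using mul_neg_of_pos_of_neg h2 h3)
  · exact NBAEquiv.exists_isFareyPair_of_pos_ratio hA htop h2 h3 h1

namespace IsFareyPair

variable {A : Matrix (Fin 2) (Fin 2) ℝ} {ξ η : ℝ}

lemma symm (h : IsFareyPair A ξ η) : IsFareyPair A η ξ :=
  ⟨h.pos_right, h.pos_left, by simpa using h.equiv.swap_rows.neg_col⟩

lemma inv (h : IsFareyPair A ξ η) : IsFareyPair A ξ⁻¹ η⁻¹ := by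
  refine ⟨inv_pos.2 h.pos_left, inv_pos.2 h.pos_right, ?_⟩
  have := h.equiv.swap_col.normalize h.pos_left.ne' (neg_ne_zero.2 h.pos_right.ne')
  simpa [div_neg] using this

lemma step (h : IsFareyPair A ξ η) (hη : 1 < η) : IsFareyPair A (ξ + 1) (η - 1) := by
  refine ⟨by linarith [h.pos_left], by linarith, ?_⟩
  have := h.equiv.add_col
  rwa [show -(η - 1) = 1 + -η by ring, add_comm ξ]

lemma ne_one (hA : A.det ≠ 0) (htop : normalizedDispersion (latticeOf A) ≠ ⊤)
    (h : IsFareyPair A ξ η) : η ≠ 1 := by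
  rintro rfl
  exact h.equiv.row_ne_zero hA htop 1 (m := 1) (n := 1) (by simp) (by simp)

/-- The box `(0, 1 + ξ) × (-η, 1)` is empty: coefficients of opposite signs violate a bound on the
second coordinate, those of equal signs one on the first. -/
lemma boxArea_le (hA : A.det ≠ 0) (h : IsFareyPair A ξ η) :
    ENNReal.ofReal (boxArea ξ η) ≤ normalizedDispersion (latticeOf A) := by
  obtain ⟨h1, h2⟩ := h.equiv.invariant hA
  have hξ := h.pos_left
  have hη := h.pos_right
  rw [← h2]
  have hd : |(!![1, ξ; 1, -η] : Matrix (Fin 2) (Fin 2) ℝ).det| = ξ + η := by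
    rw [Matrix.det_fin_two_of, abs_of_neg] <;> linarith
  have := le_normalizedDispersion h1 (x₁ := 0) (x₂ := 1 + ξ) (y₁ := -η) (y₂ := 1)
    (by linarith) (by linarith) ?_
  · rw [hd] at this
    convert this using 2
    rw [boxArea]; ring
  · intro i j h3 h4 h5 h6
    simp at h3 h4 h5 h6
    rcases le_or_gt i 0 with hi | hi <;> rcases le_or_gt j 0 with hj | hj
    · have hi' : (i : ℝ) ≤ 0 := by exact_mod_cast hi
      have hj' : (j : ℝ) ≤ 0 := by exact_mod_cast hj
      nlinarith
    · have hi' : (i : ℝ) ≤ 0 := by exact_mod_cast hi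
      have hj' : (1 : ℝ) ≤ j := by exact_mod_cast hj
      nlinarith
    · have hi' : (1 : ℝ) ≤ i := by exact_mod_cast hi
      have hj' : (j : ℝ) ≤ 0 := by exact_mod_cast hj
      nlinarith
    · have hi' : (1 : ℝ) ≤ i := by exact_mod_cast hi
      have hj' : (1 : ℝ) ≤ j := by exact_mod_cast hj
      nlinarith

end IsFareyPair

lemma IsFareyClosed.normalizedDispersion_le {P : ℝ → ℝ → Prop} (hP : IsFareyClosed P) {V : ℝ}
    (hV : ∀ ξ η, P ξ η → boxArea ξ η ≤ V) {ξ η : ℝ} (h : P ξ η) :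
    normalizedDispersion (latticeOf !![1, ξ; 1, -η]) ≤ ENNReal.ofReal V := by
  have hξ := hP.pos h
  have hη := hP.pos (hP.symm h)
  have hd' : (!![1, ξ; 1, -η] : Matrix (Fin 2) (Fin 2) ℝ).det = -(ξ + η) := by
    rw [Matrix.det_fin_two_of]; ring
  have hd : |(!![1, ξ; 1, -η] : Matrix (Fin 2) (Fin 2) ℝ).det| = ξ + η := by
    rw [hd', abs_neg, abs_of_pos (by positivity)]
  rw [normalizedDispersion_le_iff (by rw [hd']; linarith), hd]
  intro x₁ x₂ y₁ y₂ hx hy hfree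
  apply ENNReal.ofReal_le_ofReal
  rw [div_le_iff₀ (by positivity)]
  refine hP.area_le hV h hy fun i j h1 h2 h3 h4 => hfree i j ?_ ?_ ?_ ?_ <;> simp <;> linarith

/-! ### Prepending blocks of coefficients: contraction and comparison with `φ` -/

lemma goldenRatio_bounds : 1.618 < φ ∧ φ < 1.6181 := by
  have h1 : (2.236 : ℝ) < √5 := Real.lt_sqrt_of_sq_lt (by norm_num)
  have h2 : √5 < 2.2361 := by rw [Real.sqrt_lt' (by norm_num)]; norm_num
  rw [Real.goldenRatio]
  constructor <;> linarith

/-- Prepending the coefficients `1, 1` to a continued fraction. -/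
noncomputable def prependOnes (z : ℝ) : ℝ := 1 + (1 + z⁻¹)⁻¹

lemma prependOnes_eq {z : ℝ} (hz : 0 < z) : prependOnes z = (2 * z + 1) / (z + 1) := by
  rw [prependOnes]; field_simp; ring

lemma prependOnes_sub {a b : ℝ} (ha : 0 < a) (hb : 0 < b) :
    prependOnes a - prependOnes b = (a - b) / ((a + 1) * (b + 1)) := by
  rw [prependOnes_eq ha, prependOnes_eq hb]; field_simp; ring

lemma prependOnes_goldenRatio : prependOnes φ = φ := by
  have := Real.goldenRatio_sq
  have := Real.goldenRatio_pos
  rw [prependOnes_eq this, div_eq_iff (by positivity)]; nlinarith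

lemma prependOnes_sub_goldenRatio {a : ℝ} (ha : 0 < a) :
    prependOnes a - φ = (a - φ) / ((a + 1) * (φ + 1)) := by
  conv_lhs => rw [← prependOnes_goldenRatio]
  exact prependOnes_sub ha Real.goldenRatio_pos

lemma prependOnes_mem {z : ℝ} (hz : 0 < z) : 1 < prependOnes z ∧ prependOnes z < 2 := by
  rw [prependOnes_eq hz, lt_div_iff₀ (by positivity), div_lt_iff₀ (by positivity)]
  constructor <;> linarith

lemma iterate_prependOnes_mem {z : ℝ} (hz : φ ≤ z) (n : ℕ) :
    φ ≤ prependOnes^[n] z ∧ prependOnes^[n] z ≤ z := by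
  obtain ⟨hφ, hφ'⟩ := goldenRatio_bounds
  induction n with
  | zero => simpa using hz
  | succ n ih =>
    rw [Function.iterate_succ_apply']
    obtain ⟨ih1, ih2⟩ := ih
    set w := prependOnes^[n] z
    have hw : 0 < w := by linarith
    have h := prependOnes_sub_goldenRatio hw
    have h1 : 0 ≤ (w - φ) / ((w + 1) * (φ + 1)) := div_nonneg (by linarith) (by positivity)
    have h2 : (w - φ) / ((w + 1) * (φ + 1)) ≤ w - φ :=
      div_le_self (by linarith) (by nlinarith)
    constructor <;> linarith

lemma one_le_iterate_prependOnes {z : ℝ} (hz : 1 ≤ z) (n : ℕ) : 1 ≤ prependOnes^[n] z := by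
  induction n with
  | zero => simpa using hz
  | succ n ih =>
    rw [Function.iterate_succ_apply']
    exact (prependOnes_mem (by linarith)).1.le

lemma abs_prependOnes_sub_le {a b : ℝ} (ha : 1 ≤ a) (hb : 1 ≤ b) :
    |prependOnes a - prependOnes b| ≤ |a - b| / 4 := by
  rw [prependOnes_sub (by linarith) (by linarith), abs_div]
  apply div_le_div_of_nonneg_left (abs_nonneg _) (by norm_num)
  rw [abs_of_pos (by nlinarith)]; nlinarith

lemma abs_iterate_prependOnes_sub_le {a b : ℝ} (ha : 1 ≤ a) (hb : 1 ≤ b) (n : ℕ) :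
    |prependOnes^[n] a - prependOnes^[n] b| ≤ |a - b| / 4 ^ n := by
  induction n with
  | zero => simp
  | succ n ih =>
    rw [Function.iterate_succ_apply', Function.iterate_succ_apply', pow_succ, ← div_div]
    exact (abs_prependOnes_sub_le (one_le_iterate_prependOnes ha n)
      (one_le_iterate_prependOnes hb n)).trans (by gcongr)

/-- One application divides `a - φ` by `(a + 1)(φ + 1)`. For `b ≤ a` this favours the smaller side;
for `a ≤ b` monotonicity already gives the constant 1, hence the assumption `1 ≤ c`. -/
lemma iterate_prependOnes_sub_le {a b c : ℝ} (hc : 1 ≤ c) (ha : φ ≤ a) (hb : φ ≤ b)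
    (h : a - φ ≤ c * (b - φ)) (n : ℕ) :
    prependOnes^[n] a - φ ≤ c * (prependOnes^[n] b - φ) := by
  obtain ⟨hφ, hφ'⟩ := goldenRatio_bounds
  induction n with
  | zero => simpa using h
  | succ n ih =>
    rw [Function.iterate_succ_apply', Function.iterate_succ_apply']
    have ha' := (iterate_prependOnes_mem ha n).1
    have hb' := (iterate_prependOnes_mem hb n).1
    set u := prependOnes^[n] a
    set v := prependOnes^[n] b
    rw [prependOnes_sub_goldenRatio (by linarith), prependOnes_sub_goldenRatio (by linarith),
      ← mul_div_assoc, div_le_div_iff₀ (by nlinarith) (by nlinarith)]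
    have key : (u - φ) * (v + 1) ≤ c * (v - φ) * (u + 1) := by
      rcases le_total u v with huv | huv
      · have h1 : (u - φ) * (v + 1) ≤ (v - φ) * (u + 1) := by nlinarith
        have h2 : 0 ≤ (v - φ) * (u + 1) := mul_nonneg (by linarith) (by linarith)
        nlinarith
      · exact mul_le_mul ih (by linarith) (by linarith)
          (mul_nonneg (by linarith) (by linarith))
    calc (u - φ) * ((v + 1) * (φ + 1)) = (u - φ) * (v + 1) * (φ + 1) := by ring
      _ ≤ c * (v - φ) * (u + 1) * (φ + 1) := by gcongr
      _ = _ := by ring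

/-- Prepending the coefficients `1, …, 1, 2, 2`, with `2 * n` ones, to a continued fraction. -/
noncomputable def prependBlock (n : ℕ) (s : ℝ) : ℝ := prependOnes^[n] (2 + (2 + s⁻¹)⁻¹)

lemma two_block_sub {a b : ℝ} (ha : 0 < a) (hb : 0 < b) :
    (2 + (2 + a⁻¹)⁻¹) - (2 + (2 + b⁻¹)⁻¹) = (a - b) / ((2 * a + 1) * (2 * b + 1)) := by
  field_simp; ring

lemma abs_prependBlock_sub_le {a b : ℝ} (ha : 1 ≤ a) (hb : 1 ≤ b) (n : ℕ) :
    |prependBlock n a - prependBlock n b| ≤ |a - b| / 4 := by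
  have h0 : ∀ a : ℝ, 1 ≤ a → 1 ≤ 2 + (2 + a⁻¹)⁻¹ := by
    intro a ha
    have : 0 < (2 + a⁻¹)⁻¹ := by positivity
    linarith
  refine (abs_iterate_prependOnes_sub_le (h0 a ha) (h0 b hb) n).trans ?_
  refine (div_le_self (abs_nonneg _) (one_le_pow₀ (by norm_num))).trans ?_
  rw [two_block_sub (by linarith) (by linarith), abs_div]
  apply div_le_div_of_nonneg_left (abs_nonneg _) (by norm_num)
  rw [abs_of_pos (by nlinarith)]; nlinarith

/-- A bounded set, each of whose members is the contracted image of another member, lies at the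
fixed point. It is used for sets of tails of words. -/
lemma eq_of_contracting {Y : ℝ → Prop} {θ B : ℝ} (hB : ∀ y, Y y → |y - θ| ≤ B)
    (hY : ∀ y, Y y → ∃ y', Y y' ∧ |y - θ| ≤ |y' - θ| / 4) {y : ℝ} (hy : Y y) : y = θ := by
  have key : ∀ n : ℕ, ∀ y, Y y → |y - θ| ≤ B * (1 / 4) ^ n := by
    intro n
    induction n with
    | zero => intro y hy; simpa using hB y hy
    | succ n ih =>
      intro y hy
      obtain ⟨y', hy', h⟩ := hY y hy
      have := ih y' hy'
      rw [pow_succ]; linarith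
  have lim : Filter.Tendsto (fun n : ℕ => B * (1 / 4 : ℝ) ^ n) Filter.atTop (nhds (B * 0)) :=
    (tendsto_pow_atTop_nhds_zero_of_lt_one (by norm_num) (by norm_num)).const_mul B
  have h := ge_of_tendsto' lim fun n => key n y hy
  rw [mul_zero] at h
  exact sub_eq_zero.1 (abs_eq_zero.1 (le_antisymm h (abs_nonneg _)))

/-! ### Two-sided words in 1 and 2 -/

/-- `C x y` describes the positions between coefficients of two-sided infinite words in `1, 2`:
`y` is the continued fraction read to the right, `x` the one read to the left. -/
structure IsCutSystem (C : ℝ → ℝ → Prop) : Prop where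
  one_lt : ∀ {x y}, C x y → 1 < y
  symm : ∀ {x y}, C x y → C y x
  digit : ∀ {x y}, C x y → ∃ t, (y = 1 + t⁻¹ ∧ C (1 + x⁻¹) t) ∨ (y = 2 + t⁻¹ ∧ C (2 + x⁻¹) t)

namespace IsCutSystem

variable {C : ℝ → ℝ → Prop} {x y t : ℝ}

lemma lt_three (hC : IsCutSystem C) (h : C x y) : y < 3 := by
  obtain ⟨t, ⟨rfl, h2⟩ | ⟨rfl, h2⟩⟩ := hC.digit h <;>
    linarith [inv_lt_one_of_one_lt₀ (hC.one_lt h2)]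

lemma shift_one (hC : IsCutSystem C) (ht : 1 < t) (h : C x (1 + t⁻¹)) : C (1 + x⁻¹) t := by
  obtain ⟨u, ⟨h1, h2⟩ | ⟨h1, h2⟩⟩ := hC.digit h
  · rwa [inv_injective (add_left_cancel h1)]
  · have := inv_lt_one_of_one_lt₀ ht
    have : 0 < u⁻¹ := inv_pos.2 (by linarith [hC.one_lt h2])
    linarith

lemma shift_two (hC : IsCutSystem C) (ht : 1 < t) (h : C x (2 + t⁻¹)) : C (2 + x⁻¹) t := by
  obtain ⟨u, ⟨h1, h2⟩ | ⟨h1, h2⟩⟩ := hC.digit h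
  · have := inv_lt_one_of_one_lt₀ (hC.one_lt h2)
    have : 0 < t⁻¹ := inv_pos.2 (by linarith)
    linarith
  · rwa [inv_injective (add_left_cancel h1)]

lemma exists_two (hC : IsCutSystem C) (h : C x y) (hy : 2 ≤ y) : ∃ t, 1 < t ∧ y = 2 + t⁻¹ := by
  obtain ⟨t, ⟨h1, h2⟩ | ⟨h1, h2⟩⟩ := hC.digit h
  · linarith [inv_lt_one_of_one_lt₀ (hC.one_lt h2)]
  · exact ⟨t, hC.one_lt h2, h1⟩

lemma exists_one (hC : IsCutSystem C) (h : C x y) (hy : y ≤ 2) : ∃ t, 1 < t ∧ y = 1 + t⁻¹ := by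
  obtain ⟨t, ⟨h1, h2⟩ | ⟨h1, h2⟩⟩ := hC.digit h
  · exact ⟨t, hC.one_lt h2, h1⟩
  · have : 0 < t⁻¹ := inv_pos.2 (by linarith [hC.one_lt h2])
    linarith

/-- Every position inside a coefficient `2` has a box area below `(4 + √5) / 3`. -/
def IsSmall (C : ℝ → ℝ → Prop) : Prop :=
  ∀ x t, 1 < t → C x (2 + t⁻¹) → 6 * φ + 3 < 2 * x * t + x + t

/-- A position in the middle of `2, 2`, with the continued fractions on both sides of it. -/
def MidTwos (C : ℝ → ℝ → Prop) (s t : ℝ) : Prop := 1 < s ∧ 1 < t ∧ C (2 + s⁻¹) (2 + t⁻¹)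

lemma MidTwos.symm (hC : IsCutSystem C) {s t : ℝ} (h : MidTwos C s t) : MidTwos C t s :=
  ⟨h.2.1, h.1, hC.symm h.2.2⟩

lemma MidTwos.ineq (hsm : IsSmall C) {s t : ℝ} (h : MidTwos C s t) :
    (6 * φ + 3) * s < 5 * s * t + 2 * s + 1 + 2 * t := by
  obtain ⟨hs, ht, hst⟩ := h
  have h1 := hsm _ _ ht hst
  have hs0 : 0 < s := by linarith
  have h2 := mul_lt_mul_of_pos_right h1 hs0
  have : (2 * (2 + s⁻¹) * t + (2 + s⁻¹) + t) * s = 5 * s * t + 2 * s + 1 + 2 * t := by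
    field_simp; ring
  linarith

/-- The inequalities at the two adjacent coefficients 2 bound `s` from above and below in terms of
`t`. Eliminating `s` leaves a quadratic inequality in `t` that fails for `1 < t ≤ φ`. -/
lemma MidTwos.goldenRatio_lt_right (hC : IsCutSystem C) (hsm : IsSmall C) {s t : ℝ}
    (h : MidTwos C s t) : φ < t := by
  have h1 := h.ineq hsm
  have h2 := (h.symm hC).ineq hsm
  have hs := h.1
  have ht := h.2.1
  obtain ⟨hφ, hφ'⟩ := goldenRatio_bounds
  have hφ2 := Real.goldenRatio_sq
  by_contra! hc
  have h3 : s * (6 * φ + 1 - 5 * t) < 1 + 2 * t := by linarith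
  have h4 : t * (6 * φ + 1) - 1 < s * (5 * t + 2) := by linarith
  have h5 : (t * (6 * φ + 1) - 1) * (6 * φ + 1 - 5 * t) < (1 + 2 * t) * (5 * t + 2) := by
    have a1 := mul_lt_mul_of_pos_right h4 (show 0 < 6 * φ + 1 - 5 * t by linarith)
    have a2 := mul_lt_mul_of_pos_right h3 (show 0 < 5 * t + 2 by linarith)
    linarith
  have h6 : 0 ≤ (φ - t) * (5 * t - φ⁻¹) := by
    have : φ⁻¹ < 1 := inv_lt_one_of_one_lt₀ (by linarith)
    exact mul_nonneg (by linarith) (by linarith)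
  have h7 : φ⁻¹ = φ - 1 := inv_eq_of_mul_eq_one_right (by nlinarith)
  rw [h7] at h6
  -- The quadratic has the roots `φ` and `(φ - 1) / 5`.
  have h8 : (t * (6 * φ + 1) - 1) * (6 * φ + 1 - 5 * t) - (1 + 2 * t) * (5 * t + 2)
      = (6 * φ + 3) * ((φ - t) * (5 * t - (φ - 1))) := by
    linear_combination (6 * φ + 3) * hφ2
  nlinarith

end IsCutSystem

/-! ### Runs of ones next to `2, 2` -/

/-- `t` arises by prepending `2 * n` ones to a number that starts with the coefficient `2`. -/
def HasOnes (n : ℕ) (t : ℝ) : Prop :=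
  ∃ z, 7 / 3 ≤ z ∧ z ≤ φ + 1 ∧ (n ≠ 0 → z ≤ 17 / 7) ∧ t = prependOnes^[n] z

lemma inv_goldenRatio_eq : φ⁻¹ = φ - 1 :=
  inv_eq_of_mul_eq_one_right (by nlinarith [Real.goldenRatio_sq])

lemma two_add_inv_mem {s : ℝ} (h1 : φ < s) (h2 : s < 3) :
    7 / 3 ≤ 2 + s⁻¹ ∧ 2 + s⁻¹ ≤ φ + 1 := by
  obtain ⟨hφ, hφ'⟩ := goldenRatio_bounds
  have h3 : (3 : ℝ)⁻¹ ≤ s⁻¹ := inv_anti₀ (by linarith) h2.le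
  have h4 : s⁻¹ ≤ φ⁻¹ := inv_anti₀ (by linarith) h1.le
  rw [inv_goldenRatio_eq] at h4
  constructor <;> linarith

lemma two_block_mem {s : ℝ} (h1 : φ < s) (h2 : s < 3) :
    7 / 3 ≤ 2 + (2 + s⁻¹)⁻¹ ∧ 2 + (2 + s⁻¹)⁻¹ ≤ φ + 1 ∧ 2 + (2 + s⁻¹)⁻¹ ≤ 17 / 7 := by
  obtain ⟨hφ, hφ'⟩ := goldenRatio_bounds
  obtain ⟨h3, h4⟩ := two_add_inv_mem h1 h2
  have h5 : (3 : ℝ)⁻¹ ≤ (2 + s⁻¹)⁻¹ := inv_anti₀ (by linarith) (by linarith)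
  have h6 : (2 + s⁻¹)⁻¹ ≤ (7 / 3 : ℝ)⁻¹ := inv_anti₀ (by norm_num) h3
  norm_num at h6
  refine ⟨?_, ?_, ?_⟩ <;> linarith

namespace IsCutSystem

variable {C : ℝ → ℝ → Prop}

lemma MidTwos.goldenRatio_lt_left (hC : IsCutSystem C) (hsm : IsSmall C) {s t : ℝ}
    (h : MidTwos C s t) : φ < s := (h.symm hC).goldenRatio_lt_right hC hsm

lemma MidTwos.shift (hC : IsCutSystem C) {s t : ℝ} (h : MidTwos C s t) :
    C (2 + (2 + s⁻¹)⁻¹) t := hC.shift_two h.2.1 h.2.2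

lemma MidTwos.lt_three (hC : IsCutSystem C) {s t : ℝ} (h : MidTwos C s t) : t < 3 :=
  hC.lt_three (h.shift hC)

/-- If the left run were longer, `s` would carry at least one further pair of ones, which shrinks `s
- φ` by a factor of at least `(φ + 1)²` up to a constant. But the inequality at the coefficient 2
bounds `s - φ` below by a multiple of `t - φ`. -/
lemma MidTwos.le_of_hasOnes (hC : IsCutSystem C) (hsm : IsSmall C) {s t : ℝ}
    (h : MidTwos C s t) {m n : ℕ} (hs : HasOnes m s) (ht : HasOnes n t) : m ≤ n := by
  by_contra! hnm
  obtain ⟨k, rfl⟩ : ∃ k, m = n + k + 1 := ⟨m - n - 1, by omega⟩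
  obtain ⟨z', hz0, -, hz', hs⟩ := hs
  obtain ⟨z, hz1, hz2, -, ht⟩ := ht
  replace hz' := hz' (by omega)
  obtain ⟨hφ, hφ'⟩ := goldenRatio_bounds
  have hφ2 := Real.goldenRatio_sq
  have hs1 := h.goldenRatio_lt_left hC hsm
  have ht1 := h.goldenRatio_lt_right hC hsm
  have hineq := (h.symm hC).ineq hsm
  obtain ⟨hk1, hk2⟩ := iterate_prependOnes_mem (z := z') (by linarith) k
  obtain ⟨hw1, -⟩ := iterate_prependOnes_mem hk1 n
  have ht2 := (iterate_prependOnes_mem (z := z) (by linarith) n).2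
  rw [← ht] at ht2
  -- The constant `8 / 7` bounds `(17/7 - φ) / (7/3 - φ)`, the worst ratio of the starting points.
  have hc := iterate_prependOnes_sub_le (c := 8 / 7) (by norm_num) hk1
    (show φ ≤ z by linarith) (by linarith) n
  rw [← ht] at hc
  rw [Function.iterate_succ_apply', Function.iterate_add_apply] at hs
  set w := prependOnes^[n] (prependOnes^[k] z')
  have hσ := prependOnes_sub_goldenRatio (a := w) (by linarith)
  rw [← hs, eq_div_iff (mul_pos (by linarith) (by linarith)).ne'] at hσ
  -- This is `hineq` expanded around `φ`, using `φ² = φ + 1`.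
  have h1 : (φ + 1) * (t - φ) < (s - φ) * (5 * t + 2) := by nlinarith
  have h2 : (s - φ) * ((φ + 1) * (φ + 1)) ≤ 8 / 7 * (t - φ) := by
    refine le_trans ?_ (hσ.le.trans hc)
    have : 0 < s - φ := by linarith
    gcongr
  have h3 : (φ + 1) * (t - φ) * ((φ + 1) * (φ + 1)) < 8 / 7 * (t - φ) * (5 * t + 2) := by
    have a1 := mul_lt_mul_of_pos_right h1 (show 0 < (φ + 1) * (φ + 1) by positivity)
    have a2 := mul_le_mul_of_nonneg_right h2 (show 0 ≤ 5 * t + 2 by linarith)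
    linarith
  -- Dividing by `t - φ > 0` leaves a numerical contradiction: the left side is `8φ + 5`, about
  -- 17.94, and `t ≤ φ + 1` keeps the right side below 17.3.
  have h4 : (φ + 1) * ((φ + 1) * (φ + 1)) < 8 / 7 * (5 * t + 2) := by
    by_contra! h5
    have := mul_le_mul_of_nonneg_left h5 (show 0 ≤ t - φ by linarith)
    linarith
  have h5 : (φ + 1) * ((φ + 1) * (φ + 1)) = 8 * φ + 5 := by
    linear_combination (φ + 4) * hφ2
  linarith

/-- A tail in `(φ, 2]` starts with `1, 1`: after a single 1 followed by a 2 it would be below `φ`.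
Removing this pair multiplies the distance to `φ` by at least 4, while tails stay below 3, so at
most `N` pairs can be removed. -/
lemma exists_iterate_of_lt (hC : IsCutSystem C) (N : ℕ) : ∀ w t : ℝ, C w t → φ < t →
    3 ≤ φ + 4 ^ N * (t - φ) →
    ∃ (n : ℕ) (u : ℝ), 1 < u ∧ t = prependOnes^[n] (2 + u⁻¹) ∧
      C (prependOnes^[n] w) (2 + u⁻¹) := by
  induction N with
  | zero =>
    intro w t h _ h3
    linarith [hC.lt_three h]
  | succ N ih =>
    intro w t h ht h3
    obtain ⟨hφ, hφ'⟩ := goldenRatio_bounds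
    rcases le_total 2 t with h2 | h2
    · obtain ⟨u, hu, rfl⟩ := hC.exists_two h h2
      exact ⟨0, u, hu, rfl, h⟩
    obtain ⟨a, ha, rfl⟩ := hC.exists_one h h2
    have ha2 : a ≤ 2 := by
      by_contra! hc
      have : a⁻¹ < 2⁻¹ := inv_strictAnti₀ (by norm_num) hc
      norm_num at this; linarith
    have h4 := hC.shift_one ha h
    obtain ⟨b, hb, rfl⟩ := hC.exists_one h4 ha2
    have h5 := hC.shift_one hb h4
    have h6 : C (prependOnes w) b := h5
    have h7 : prependOnes b - φ = (b - φ) / ((b + 1) * (φ + 1)) :=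
      prependOnes_sub_goldenRatio (by linarith)
    change φ < prependOnes b at ht
    change 3 ≤ φ + 4 ^ (N + 1) * (prependOnes b - φ) at h3
    have h8 : 4 * (prependOnes b - φ) ≤ b - φ := by
      rw [eq_div_iff (by positivity)] at h7
      rw [← h7, mul_comm]
      have : 0 < prependOnes b - φ := by linarith
      gcongr
      nlinarith
    obtain ⟨n, u, hu, h9, h10⟩ := ih _ _ h6 (by linarith) (h3.trans (by
      rw [pow_succ, mul_assoc]; gcongr))
    exact ⟨n + 1, u, hu, by rw [Function.iterate_succ_apply', ← h9]; rfl, by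
      rwa [Function.iterate_succ_apply', ← Function.iterate_succ_apply' prependOnes,
        Function.iterate_succ_apply]⟩

lemma MidTwos.exists_iterate (hC : IsCutSystem C) (hsm : IsSmall C) {s t : ℝ}
    (h : MidTwos C s t) : ∃ (n : ℕ) (u : ℝ), 1 < u ∧ t = prependOnes^[n] (2 + u⁻¹) ∧
      C (prependBlock n s) (2 + u⁻¹) := by
  have ht := h.goldenRatio_lt_right hC hsm
  obtain ⟨N, hN⟩ := pow_unbounded_of_one_lt (3 / (t - φ)) (show (1 : ℝ) < 4 by norm_num)
  rw [div_lt_iff₀ (by linarith)] at hN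
  exact hC.exists_iterate_of_lt N _ _ (h.shift hC) ht (by linarith [goldenRatio_bounds.1])

/-- After a nonempty run of ones, the next 2 has a 1 to its left, so its right neighbour is a 2 and
a new middle of `2, 2` appears. With an empty run the middle just moves by one coefficient. -/
lemma MidTwos.exists_next (hC : IsCutSystem C) (hsm : IsSmall C) {s t : ℝ}
    (h : MidTwos C s t) : ∃ n, HasOnes n t ∧
      ((n = 0 ∧ ∃ u, t = 2 + u⁻¹ ∧ MidTwos C (2 + s⁻¹) u) ∨
        ∃ u, t = prependBlock n u ∧ MidTwos C (prependBlock n s) u) := by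
  obtain ⟨hφ, hφ'⟩ := goldenRatio_bounds
  obtain ⟨n, u, hu, rfl, hCu⟩ := h.exists_iterate hC hsm
  rcases n with _ | n
  · have h1 : MidTwos C (2 + s⁻¹) u :=
      ⟨by linarith [inv_pos.2 (show 0 < s by linarith [h.1])], hu, hCu⟩
    obtain ⟨h2, h3⟩ := two_add_inv_mem (h1.goldenRatio_lt_right hC hsm) (h1.lt_three hC)
    exact ⟨0, ⟨_, h2, h3, by simp, rfl⟩, .inl ⟨rfl, u, rfl, h1⟩⟩
  · set w := prependBlock (n + 1) s with hw
    have hs0 : 0 < s := by linarith [h.1]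
    have hw2 : 1 < w ∧ w < 2 := by
      rw [hw, prependBlock, Function.iterate_succ_apply']
      have h0 : 0 < (2 + s⁻¹)⁻¹ := by positivity
      have h1 := one_le_iterate_prependOnes (show 1 ≤ 2 + (2 + s⁻¹)⁻¹ by linarith) n
      exact prependOnes_mem (by linarith)
    obtain ⟨hw1, hw2⟩ := hw2
    have h1 := hsm _ _ hu hCu
    -- If also `u < 2`, then `2wu + w + u < 12 < 6φ + 3`.
    have hu2 : 2 ≤ u := by
      by_contra! hc
      nlinarith
    have h2 := hC.shift_two hu hCu
    obtain ⟨v, hv, rfl⟩ := hC.exists_two h2 hu2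
    have h3 : MidTwos C w v := ⟨hw1, hv, h2⟩
    obtain ⟨h4, h5, h6⟩ := two_block_mem (h3.goldenRatio_lt_right hC hsm) (h3.lt_three hC)
    exact ⟨n + 1, ⟨_, h4, h5, fun _ => h6, rfl⟩, .inr ⟨v, rfl, h3⟩⟩

lemma MidTwos.exists_next_of_hasOnes (hC : IsCutSystem C) (hsm : IsSmall C) {s t : ℝ} {n : ℕ}
    (h : MidTwos C s t) (hs : HasOnes n s) : HasOnes n t ∧
      ∃ u, t = prependBlock n u ∧ MidTwos C (prependBlock n s) u := by
  have huniq : ∀ {s t : ℝ} {m n : ℕ}, MidTwos C s t → HasOnes m s → HasOnes n t → n = m :=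
    fun h hs ht => le_antisymm ((h.symm hC).le_of_hasOnes hC hsm ht hs)
      (h.le_of_hasOnes hC hsm hs ht)
  obtain ⟨m, ht, h1⟩ := h.exists_next hC hsm
  obtain rfl := huniq h hs ht
  refine ⟨ht, ?_⟩
  -- For `n = 0` one move passes only half of the block `2, 2`. At the new middle the left run is
  -- again empty, hence so is the right one, and a further 2 can be removed.
  obtain ⟨rfl, u, rfl, h2⟩ | h1 := h1
  · obtain ⟨h3, h4⟩ := two_add_inv_mem (h.goldenRatio_lt_left hC hsm) ((h.symm hC).lt_three hC)
    have h5 : HasOnes 0 (2 + s⁻¹) := ⟨_, h3, h4, by simp, rfl⟩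
    obtain ⟨m, hu, h6⟩ := h2.exists_next hC hsm
    obtain rfl := huniq h2 h5 hu
    obtain ⟨-, v, rfl, h7⟩ | ⟨v, hv, h7⟩ := h6
    · exact ⟨v, rfl, h7⟩
    · obtain ⟨a, ha⟩ := hC.exists_two (h2.shift hC) (by
        rw [hv, prependBlock]
        have hv0 : 0 < v := by linarith [h7.2.1]
        have : 0 < (2 + v⁻¹)⁻¹ := by positivity
        simp only [Function.iterate_zero, id]
        linarith)
      refine ⟨a, by rw [ha.2]; rfl, ?_, ha.1, ?_⟩
      · have : 0 < (2 + s⁻¹)⁻¹ := inv_pos.2 (by linarith)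
        simp only [prependBlock, Function.iterate_zero, id]; linarith
      · have := h2.shift hC
        rwa [ha.2] at this
  · exact h1

lemma MidTwos.hasOnes_prependBlock (hC : IsCutSystem C) (hsm : IsSmall C) {s t : ℝ}
    (h : MidTwos C s t) (n : ℕ) : HasOnes n (prependBlock n s) := by
  obtain ⟨h1, h2, h3⟩ := two_block_mem (h.goldenRatio_lt_left hC hsm) ((h.symm hC).lt_three hC)
  exact ⟨_, h1, h2, fun _ => h3, rfl⟩

/-- The run length `n` propagates to all later middles, so the tail is an infinitely iterated image
under the contraction `prependBlock n`. -/
lemma MidTwos.eq_fixedPoint (hC : IsCutSystem C) (hsm : IsSmall C) {s t θ : ℝ} {n : ℕ}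
    (h : MidTwos C s t) (hs : HasOnes n s) (hθ1 : 1 ≤ θ) (hθ : θ = prependBlock n θ) :
    t = θ := by
  refine eq_of_contracting (Y := fun t => ∃ s, MidTwos C s t ∧ HasOnes n s) (B := θ + 3)
    ?_ ?_ ⟨s, h, hs⟩
  · rintro y ⟨s, h, -⟩
    have h1 := h.lt_three hC
    have h2 := h.2.1
    rw [abs_le]; constructor <;> linarith
  · rintro y ⟨s, h, hs⟩
    obtain ⟨-, u, hu, h1⟩ := h.exists_next_of_hasOnes hC hsm hs
    refine ⟨u, ⟨_, h1, h.hasOnes_prependBlock hC hsm n⟩, ?_⟩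
    rw [hu]
    conv_lhs => rw [hθ]
    exact abs_prependBlock_sub_le h1.2.1.le hθ1 n

lemma MidTwos.eq_fixedPoint_both (hC : IsCutSystem C) (hsm : IsSmall C) {s t : ℝ} {θ : ℕ → ℝ}
    (hθ1 : ∀ n, 1 ≤ θ n) (hθ : ∀ n, θ n = prependBlock n (θ n))
    (h : MidTwos C s t) : ∃ n, s = θ n ∧ t = θ n := by
  obtain ⟨n, ht, -⟩ := h.exists_next hC hsm
  have hs := ((h.symm hC).exists_next_of_hasOnes hC hsm ht).1
  exact ⟨n, (h.symm hC).eq_fixedPoint hC hsm ht (hθ1 n) (hθ n),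
    h.eq_fixedPoint hC hsm hs (hθ1 n) (hθ n)⟩

lemma eq_goldenRatio (hC : IsCutSystem C) (hlt : ∀ x y, C x y → y < 2) {x y : ℝ}
    (h : C x y) : y = φ := by
  obtain ⟨hφ, hφ'⟩ := goldenRatio_bounds
  refine eq_of_contracting (Y := fun y => ∃ x, C x y) (B := 2) ?_ ?_ ⟨x, h⟩
  · rintro y ⟨x, h⟩
    have h1 := hlt _ _ h
    have h2 := hC.one_lt h
    rw [abs_le]; constructor <;> linarith
  · rintro y ⟨x, h⟩
    obtain ⟨a, ha, rfl⟩ := hC.exists_one h (hlt _ _ h).le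
    have h1 := hC.shift_one ha h
    obtain ⟨b, hb, rfl⟩ := hC.exists_one h1 (hlt _ _ h1).le
    refine ⟨b, ⟨_, hC.shift_one hb h1⟩, ?_⟩
    conv_lhs => rw [← prependOnes_goldenRatio]
    exact abs_prependOnes_sub_le hb.le (by linarith)

/-- Small systems consist of the positions in the words `…1111…` and `…221…122…`. -/
theorem classification (hC : IsCutSystem C) (hsm : IsSmall C) {θ : ℕ → ℝ}
    (hθ1 : ∀ n, 1 ≤ θ n) (hθ : ∀ n, θ n = prependBlock n (θ n)) {x₀ y₀ : ℝ} (h₀ : C x₀ y₀) :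
    C φ φ ∨ ∃ n, C (2 + (θ n)⁻¹) (2 + (θ n)⁻¹) := by
  obtain ⟨hφ, hφ'⟩ := goldenRatio_bounds
  by_cases hlt : ∀ x y, C x y → y < 2
  · left
    have h1 := hC.eq_goldenRatio hlt h₀
    have h2 := hC.eq_goldenRatio hlt (hC.symm h₀)
    rwa [h1, h2] at h₀
  right
  push Not at hlt
  obtain ⟨x, y, hxy, hy⟩ := hlt
  suffices ∃ s t, MidTwos C s t by
    obtain ⟨s, t, h⟩ := this
    obtain ⟨n, rfl, rfl⟩ := h.eq_fixedPoint_both hC hsm hθ1 hθ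
    exact ⟨n, h.2.2⟩
  obtain ⟨t, ht, rfl⟩ := hC.exists_two hxy hy
  have hx1 := hC.one_lt (hC.symm hxy)
  rcases le_total 2 x with hx | hx
  · obtain ⟨s, hs, rfl⟩ := hC.exists_two (hC.symm hxy) hx
    exact ⟨s, t, hs, ht, hxy⟩
  · have h1 := hC.shift_two ht hxy
    -- An isolated 2 would have `x ≤ 2` and `t < 2`, against smallness; so a left neighbour 1 forces
    -- a right neighbour 2.
    have ht2 : 2 ≤ t := by
      by_contra! hc
      nlinarith [hsm _ _ ht hxy]
    obtain ⟨u, hu, rfl⟩ := hC.exists_two h1 ht2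
    exact ⟨x, u, hx1, hu, h1⟩

end IsCutSystem

/-! ### Box areas along a continued fraction -/

lemma boxArea_mid {x t : ℝ} (hx : 0 < x) (ht : 0 < t) :
    boxArea (1 + x⁻¹) (1 + t⁻¹) = 2 + (2 * x * t + x + t)⁻¹ := by
  rw [boxArea]; field_simp; ring

lemma boxArea_inv {ξ η : ℝ} (hξ : 0 < ξ) (hη : 0 < η) : boxArea ξ⁻¹ η⁻¹ = boxArea ξ η := by
  rw [boxArea, boxArea]; field_simp; ring

/-- Equivalent to `(1 - x⁻¹)(y - 1) ≥ 0`; hence only boxes inside a coefficient can exceed 2. -/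
lemma boxArea_le_two {x y : ℝ} (hx : 1 < x) (hy : 1 < y) : boxArea x⁻¹ y ≤ 2 := by
  have h1 := inv_lt_one_of_one_lt₀ hx
  have h2 : 0 < x⁻¹ := by positivity
  rw [boxArea, div_le_iff₀ (by positivity)]
  nlinarith

lemma limit_sub_two : (4 + √5) / 3 = 2 + (6 * φ + 3)⁻¹ := by
  have h5 : √5 ^ 2 = 5 := Real.sq_sqrt (by norm_num)
  have h0 : 0 < √5 := by positivity
  have h6 : 6 * φ + 3 = 6 + 3 * √5 := by rw [Real.goldenRatio]; ring
  rw [h6]; field_simp; nlinarith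

lemma limit_lt : (4 + √5) / 3 < 2.08 := by
  have h2 : √5 < 2.2361 := by rw [Real.sqrt_lt' (by norm_num)]; norm_num
  linarith

/-! ### Cuts of a lattice with dispersion below the limit -/

section CutsOfLattice

variable {A : Matrix (Fin 2) (Fin 2) ℝ}

/-- The positions between the coefficients of the two-sided continued fraction of a lattice. -/
def LatticeCut (A : Matrix (Fin 2) (Fin 2) ℝ) (x y : ℝ) : Prop :=
  1 < x ∧ 1 < y ∧ IsFareyPair A x⁻¹ y

lemma LatticeCut.symm {x y : ℝ} (h : LatticeCut A x y) : LatticeCut A y x :=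
  ⟨h.2.1, h.1, by simpa using h.2.2.symm.inv⟩

variable (hA : A.det ≠ 0)
  (hlim : normalizedDispersion (latticeOf A) < ENNReal.ofReal ((4 + √5) / 3))

include hA hlim

lemma IsFareyPair.boxArea_lt {ξ η : ℝ} (h : IsFareyPair A ξ η) :
    boxArea ξ η < (4 + √5) / 3 := by
  by_contra! hc
  exact (hlim.trans_le (ENNReal.ofReal_le_ofReal hc)).not_ge (h.boxArea_le hA)

/-- Two steps into a coefficient at least 4, both `ξ` and `η` are at least 2, which gives area at
least `9 / 4`. -/
lemma LatticeCut.lt_four {x y : ℝ} (h : LatticeCut A x y) : y < 4 := by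
  by_contra! hc
  obtain ⟨hx, hy, hp⟩ := h
  have h1 := ((hp.step hy).step (by linarith)).boxArea_lt hA hlim
  have h2 := h1.trans limit_lt
  have hx0 : 0 < x⁻¹ := by positivity
  rw [boxArea, div_lt_iff₀ (by linarith)] at h2
  nlinarith

lemma LatticeCut.ne_two {x y : ℝ} (h : LatticeCut A x y) : y ≠ 2 := by
  rintro rfl
  exact (h.2.2.step one_lt_two).ne_one hA hlim.ne_top (by norm_num)

/-- Around a coefficient 3 the adjacent tails are below 4, so one step into it `ξ > 5/4` and `η >
9/4`; the area then exceeds `2.08`. -/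
lemma LatticeCut.lt_three {x y : ℝ} (h : LatticeCut A x y) : y < 3 := by
  by_contra! hc
  have hy4 := h.lt_four hA hlim
  have hx4 := h.symm.lt_four hA hlim
  obtain ⟨hx, hy, hp⟩ := h
  have hx0 : 0 < x⁻¹ := by positivity
  have h2 := (hp.step hy).step (by linarith)
  have h3 : 3 < y := by
    have := h2.ne_one hA hlim.ne_top
    refine lt_of_le_of_ne hc fun e => this (by linarith)
  have h4 := (h2.step (by linarith)).inv
  have h5 : 1 < (y - 1 - 1 - 1)⁻¹ := (one_lt_inv₀ (by linarith)).2 (by linarith)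
  have h6 : LatticeCut A (x⁻¹ + 1 + 1 + 1) (y - 1 - 1 - 1)⁻¹ := ⟨by linarith, h5, h4⟩
  have h7 := h6.lt_four hA hlim
  rw [inv_lt_comm₀ (by linarith) (by norm_num)] at h7
  have h8 : (4 : ℝ)⁻¹ < x⁻¹ := inv_strictAnti₀ (by linarith) hx4
  have h9 := ((hp.step hy).boxArea_lt hA hlim).trans limit_lt
  rw [boxArea, div_lt_iff₀ (by linarith)] at h9
  norm_num at h7 h8
  nlinarith

lemma isCutSystem_latticeCut : IsCutSystem (LatticeCut A) := by
  refine ⟨fun h => h.2.1, fun h => h.symm, fun {x y} h => ?_⟩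
  have h3 := h.lt_three hA hlim
  have h2 := h.ne_two hA hlim
  obtain ⟨hx, hy, hp⟩ := h
  have hx0 : 0 < x⁻¹ := by positivity
  have hp1 := hp.step hy
  rcases lt_or_gt_of_ne h2 with hlt | hgt
  · refine ⟨(y - 1)⁻¹, .inl ⟨by simp, by linarith, (one_lt_inv₀ (by linarith)).2 (by linarith), ?_⟩⟩
    rw [add_comm]
    exact hp1.inv
  · refine ⟨(y - 2)⁻¹, .inr ⟨by simp, by linarith, (one_lt_inv₀ (by linarith)).2 (by linarith), ?_⟩⟩
    have := (hp1.step (by linarith)).inv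
    convert this using 2 <;> ring

lemma isSmall_latticeCut : IsCutSystem.IsSmall (LatticeCut A) := by
  rintro x t ht ⟨hx, hy, hp⟩
  have h1 := (hp.step hy).boxArea_lt hA hlim
  have h2 : 2 + t⁻¹ - 1 = 1 + t⁻¹ := by ring
  rw [h2, add_comm x⁻¹, boxArea_mid (by linarith) (by linarith), limit_sub_two] at h1
  have h3 : 0 < 6 * φ + 3 := by have := Real.goldenRatio_pos; positivity
  exact (inv_lt_inv₀ (by positivity) h3).1 (by linarith)

/-- Steps raise `ξ` and lower `η` by 1; when `η` falls below 1, a position between two coefficients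
is reached. -/
lemma exists_latticeCut_of_one_lt (n : ℕ) : ∀ {ξ η : ℝ}, 1 < ξ → η < n + 1 →
    IsFareyPair A ξ η → ∃ x y, LatticeCut A x y := by
  have base : ∀ {ξ η : ℝ}, 1 < ξ → η < 1 → IsFareyPair A ξ η → ∃ x y, LatticeCut A x y :=
    fun hξ hη h => ⟨_, _, (one_lt_inv₀ h.pos_right).2 hη, hξ, by simpa using h.symm⟩
  induction n with
  | zero => intro ξ η hξ hη h; exact base hξ (by simpa using hη) h
  | succ n ih =>
    intro ξ η hξ hη h
    push_cast at hη
    rcases lt_or_gt_of_ne (h.ne_one hA hlim.ne_top) with h1 | h1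
    · exact base hξ h1 h
    · exact ih (by linarith) (by linarith) (h.step h1)

lemma exists_latticeCut : ∃ x y, LatticeCut A x y := by
  obtain ⟨ξ, η, h⟩ := exists_isFareyPair hA hlim.ne_top
  suffices ∃ ξ η, 1 < ξ ∧ IsFareyPair A ξ η by
    obtain ⟨ξ, η, hξ, h⟩ := this
    obtain ⟨n, hn⟩ := exists_nat_gt η
    exact exists_latticeCut_of_one_lt hA hlim n hξ (by linarith) h
  rcases lt_or_gt_of_ne (h.ne_one hA hlim.ne_top) with h1 | h1
  · exact ⟨_, _, (one_lt_inv₀ h.pos_right).2 h1, h.symm.inv⟩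
  · exact ⟨_, _, h1, h.symm⟩

end CutsOfLattice

/-! ### Upper bounds for the dispersion from a cut system -/

/-- The pairs `(ξ, η)` visited by the Farey moves along a cut system. -/
def IsCutSystem.Pairs (C : ℝ → ℝ → Prop) (ξ η : ℝ) : Prop :=
  (∃ x y, C x y ∧ ((ξ = x⁻¹ ∧ η = y) ∨ (ξ = x ∧ η = y⁻¹))) ∨
    ∃ x t, C x (2 + t⁻¹) ∧ 1 < t ∧
      ((ξ = 1 + x⁻¹ ∧ η = 1 + t⁻¹) ∨ (ξ = (1 + x⁻¹)⁻¹ ∧ η = (1 + t⁻¹)⁻¹))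

/-- A step passes a coefficient 1 completely, and a coefficient 2 in two halves, the intermediate
pair being its middle. -/
lemma IsCutSystem.isFareyClosed_pairs {C : ℝ → ℝ → Prop} (hC : IsCutSystem C) :
    IsFareyClosed (Pairs C) where
  pos := by
    rintro ξ η (⟨x, y, h, ⟨rfl, rfl⟩ | ⟨rfl, rfl⟩⟩ | ⟨x, t, h, ht, ⟨rfl, rfl⟩ | ⟨rfl, rfl⟩⟩)
    all_goals have hx := zero_lt_one.trans (hC.one_lt (hC.symm h))
    all_goals positivity
  ne_one := by
    rintro ξ η (⟨x, y, h, ⟨rfl, rfl⟩ | ⟨rfl, rfl⟩⟩ | ⟨x, t, h, ht, ⟨rfl, rfl⟩ | ⟨rfl, rfl⟩⟩)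
    · exact (hC.one_lt h).ne'
    · exact (inv_lt_one_of_one_lt₀ (hC.one_lt h)).ne
    · have : 0 < t⁻¹ := by positivity
      linarith
    · have : 0 < t⁻¹ := by positivity
      exact (inv_lt_one_of_one_lt₀ (by linarith)).ne
  symm := by
    rintro ξ η (⟨x, y, h, ⟨rfl, rfl⟩ | ⟨rfl, rfl⟩⟩ | ⟨x, t, h, ht, ⟨rfl, rfl⟩ | ⟨rfl, rfl⟩⟩)
    · exact .inl ⟨_, _, hC.symm h, .inr ⟨rfl, rfl⟩⟩
    · exact .inl ⟨_, _, hC.symm h, .inl ⟨rfl, rfl⟩⟩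
    · exact .inr ⟨t, x, hC.symm (hC.shift_two ht h), hC.one_lt (hC.symm h), .inl ⟨rfl, rfl⟩⟩
    · exact .inr ⟨t, x, hC.symm (hC.shift_two ht h), hC.one_lt (hC.symm h), .inr ⟨rfl, rfl⟩⟩
  inv := by
    rintro ξ η (⟨x, y, h, ⟨rfl, rfl⟩ | ⟨rfl, rfl⟩⟩ | ⟨x, t, h, ht, ⟨rfl, rfl⟩ | ⟨rfl, rfl⟩⟩)
    · exact .inl ⟨_, _, h, .inr ⟨inv_inv _, rfl⟩⟩
    · exact .inl ⟨_, _, h, .inl ⟨rfl, inv_inv _⟩⟩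
    · exact .inr ⟨x, t, h, ht, .inr ⟨rfl, rfl⟩⟩
    · exact .inr ⟨x, t, h, ht, .inl ⟨inv_inv _, inv_inv _⟩⟩
  step := by
    rintro ξ η (⟨x, y, h, ⟨rfl, rfl⟩ | ⟨rfl, rfl⟩⟩ | ⟨x, t, h, ht, ⟨rfl, rfl⟩ | ⟨rfl, rfl⟩⟩) hη
    · obtain ⟨t, ⟨rfl, h1⟩ | ⟨rfl, h1⟩⟩ := hC.digit h
      · exact .inl ⟨_, _, h1, .inr ⟨add_comm _ _, by ring⟩⟩
      · exact .inr ⟨x, t, h, hC.one_lt h1, .inl ⟨add_comm _ _, by ring⟩⟩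
    · exact absurd hη (inv_lt_one_of_one_lt₀ (hC.one_lt h)).not_gt
    · exact .inl ⟨_, _, hC.shift_two ht h, .inr ⟨by ring, by ring⟩⟩
    · have : 0 < t⁻¹ := by positivity
      exact absurd hη (inv_lt_one_of_one_lt₀ (by linarith)).not_gt

lemma IsFareyPair.normalizedDispersion_le {A : Matrix (Fin 2) (Fin 2) ℝ} (hA : A.det ≠ 0)
    {C : ℝ → ℝ → Prop} (hC : IsCutSystem C) {V : ℝ}
    (hV₁ : ∀ x y, C x y → boxArea x⁻¹ y ≤ V)
    (hV₂ : ∀ x t, 1 < t → C x (2 + t⁻¹) → 2 + (2 * x * t + x + t)⁻¹ ≤ V) {x y : ℝ}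
    (hxy : C x y) (h : IsFareyPair A x⁻¹ y) :
    normalizedDispersion (latticeOf A) ≤ ENNReal.ofReal V := by
  rw [← (h.equiv.invariant hA).2]
  refine hC.isFareyClosed_pairs.normalizedDispersion_le ?_ (.inl ⟨x, y, hxy, .inl ⟨rfl, rfl⟩⟩)
  rintro ξ η (⟨x, y, h, ⟨rfl, rfl⟩ | ⟨rfl, rfl⟩⟩ | ⟨x, t, h, ht, ⟨rfl, rfl⟩ | ⟨rfl, rfl⟩⟩)
  · exact hV₁ _ _ h
  · have hx := hC.one_lt (hC.symm h)
    have := hV₁ _ _ h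
    rwa [← boxArea_inv (by positivity) (by linarith [hC.one_lt h]), inv_inv] at this
  all_goals
    have hx := hC.one_lt (hC.symm h)
    first
      | rw [boxArea_inv (by positivity) (by positivity)]
      | skip
    rw [boxArea_mid (by linarith) (by linarith)]
    exact hV₂ _ _ ht h

/-! ### The golden lattice -/

lemma isCutSystem_golden : IsCutSystem fun x y => x = φ ∧ y = φ where
  one_lt := by rintro x y ⟨-, rfl⟩; exact Real.one_lt_goldenRatio
  symm := fun h => h.symm
  digit := by
    rintro x y ⟨rfl, rfl⟩
    exact ⟨φ, .inl ⟨by rw [inv_goldenRatio_eq]; ring, by rw [inv_goldenRatio_eq]; ring, rfl⟩⟩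

lemma isFareyPair_golden : IsFareyPair !![1, φ; 1, ψ] φ⁻¹ φ := by
  have h0 := Real.goldenRatio_pos
  have : IsFareyPair !![1, φ; 1, ψ] φ φ⁻¹ :=
    ⟨h0, inv_pos.2 h0, by rw [Real.inv_goldenRatio, neg_neg]; exact .refl⟩
  simpa using this.inv

lemma boxArea_golden : boxArea φ⁻¹ φ = φ ^ 3 / √5 := by
  have h1 : φ⁻¹ + φ = √5 := by rw [inv_goldenRatio_eq, Real.goldenRatio]; ring
  rw [boxArea, h1, inv_goldenRatio_eq]
  congr 1
  linear_combination (-φ) * Real.goldenRatio_sq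

lemma det_golden_ne_zero : (!![1, φ; 1, ψ] : Matrix (Fin 2) (Fin 2) ℝ).det ≠ 0 := by
  rw [Matrix.det_fin_two_of]
  linarith [Real.goldenRatio_pos, Real.goldenConj_neg]

lemma normalizedDispersion_golden :
    normalizedDispersion (latticeOf !![1, φ; 1, ψ]) = ENNReal.ofReal (φ ^ 3 / √5) := by
  rw [← boxArea_golden]
  refine le_antisymm ?_ (isFareyPair_golden.boxArea_le det_golden_ne_zero)
  refine isFareyPair_golden.normalizedDispersion_le det_golden_ne_zero isCutSystem_golden
    ?_ ?_ ⟨rfl, rfl⟩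
  · rintro x y ⟨rfl, rfl⟩; exact le_rfl
  · rintro x t ht ⟨rfl, h⟩
    have : 0 < t⁻¹ := by positivity
    linarith [goldenRatio_bounds.2]

/-! ### The lattices with expansions `2, 1, …, 1, 2` -/

/-- Half of the trace of the quadratic number `[2, 1, …, 1, 2, …]`. -/
def bestHalfTrace (n : ℕ) : ℚ :=
  (4 * Nat.fib (2 * n + 1) + 3 * Nat.fib (2 * n)) /
    (2 * (2 * Nat.fib (2 * n + 1) + Nat.fib (2 * n)))

/-- The quadratic number with purely periodic continued fraction of period `2, 1, …, 1, 2`, with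
`2 * n` ones. -/
noncomputable def bestNumber (n : ℕ) : ℝ := bestHalfTrace n + √((bestHalfTrace n : ℝ) ^ 2 + 1)

/-- The continued fraction of `bestNumber` without its first coefficient. -/
noncomputable def bestTail (n : ℕ) : ℝ := (bestNumber n - 2)⁻¹

lemma bestNumber_pos (n : ℕ) : 0 < bestNumber n := by
  have : |(bestHalfTrace n : ℝ)| < √((bestHalfTrace n : ℝ) ^ 2 + 1) :=
    Real.lt_sqrt_of_sq_lt (by rw [sq_abs]; linarith)
  have := neg_abs_le (bestHalfTrace n : ℝ)
  rw [bestNumber]; linarith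

/-- The roots have product -1, so the conjugate is the negative inverse; this reflects the
palindromic period. -/
lemma bestNumber_sq (n : ℕ) :
    bestNumber n ^ 2 = 2 * bestHalfTrace n * bestNumber n + 1 := by
  have : √((bestHalfTrace n : ℝ) ^ 2 + 1) ^ 2 = (bestHalfTrace n : ℝ) ^ 2 + 1 :=
    Real.sq_sqrt (by positivity)
  rw [bestNumber]; nlinarith

lemma bestNumber_equation (n : ℕ) :
    (2 * Nat.fib (2 * n + 1) + Nat.fib (2 * n)) * bestNumber n ^ 2 =
      (4 * Nat.fib (2 * n + 1) + 3 * Nat.fib (2 * n)) * bestNumber n +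
        (2 * Nat.fib (2 * n + 1) + Nat.fib (2 * n)) := by
  have h1 : (0 : ℝ) < Nat.fib (2 * n + 1) := by exact_mod_cast Nat.fib_pos.2 (by omega)
  rw [bestNumber_sq, bestHalfTrace]; push_cast; field_simp

lemma bestNumber_bounds (n : ℕ) : 2 < bestNumber n ∧ bestNumber n < 3 := by
  have h0 := bestNumber_pos n
  have h := bestNumber_equation n
  have h1 : (0 : ℝ) < Nat.fib (2 * n + 1) := by exact_mod_cast Nat.fib_pos.2 (by omega)
  have h2 : (0 : ℝ) ≤ Nat.fib (2 * n) := by positivity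
  have h3 : (Nat.fib (2 * n) : ℝ) ≤ Nat.fib (2 * n + 1) := by
    exact_mod_cast Nat.fib_mono (by omega)
  set a : ℝ := (Nat.fib (2 * n + 1) : ℝ)
  set b : ℝ := (Nat.fib (2 * n) : ℝ)
  set D := bestNumber n
  constructor
  · by_contra! hc
    have h4 : a * (2 * D ^ 2 - 4 * D - 2) + b * (D ^ 2 - 3 * D - 1) = 0 := by linarith
    have h5 : 2 * D ^ 2 - 4 * D - 2 < 0 := by nlinarith
    have h6 : D ^ 2 - 3 * D - 1 ≤ 0 := by nlinarith
    nlinarith [mul_pos_of_neg_of_neg (neg_lt_zero.2 h1) h5, mul_nonneg h2 (neg_nonneg.2 h6)]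
  · by_contra! hc
    have h4 : a * (2 * D ^ 2 - 4 * D - 2) + b * (D ^ 2 - 3 * D - 1) = 0 := by linarith
    have h5 : 0 < 2 * D ^ 2 - 4 * D - 2 := by nlinarith
    have h6 : -1 ≤ D ^ 2 - 3 * D - 1 := by nlinarith
    have h7 : 4 ≤ 2 * D ^ 2 - 4 * D - 2 := by nlinarith
    nlinarith [mul_le_mul_of_nonneg_left h7 h1.le, mul_le_mul_of_nonneg_left h6 h2]

lemma one_lt_bestTail (n : ℕ) : 1 < bestTail n := by
  obtain ⟨h1, h2⟩ := bestNumber_bounds n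
  exact (one_lt_inv₀ (by linarith)).2 (by linarith)

lemma bestNumber_eq (n : ℕ) : bestNumber n = 2 + (bestTail n)⁻¹ := by
  rw [bestTail, inv_inv]; ring

/-- The powers of the matrix `(2, 1; 1, 1)` have Fibonacci entries. The last entry is the difference
`F(2n+1) - F(2n)`, which makes sense at `n = 0` too. -/
lemma iterate_prependOnes_fib {z : ℝ} (hz : 0 < z) (n : ℕ) :
    0 < prependOnes^[n] z ∧
    prependOnes^[n] z * (Nat.fib (2 * n) * z + (Nat.fib (2 * n + 1) - Nat.fib (2 * n))) =
      Nat.fib (2 * n + 1) * z + Nat.fib (2 * n) := by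
  induction n with
  | zero => simpa using hz
  | succ n ih =>
    obtain ⟨h1, h2⟩ := ih
    rw [Function.iterate_succ_apply', prependOnes_eq h1]
    have e1 : Nat.fib (2 * (n + 1)) = Nat.fib (2 * n) + Nat.fib (2 * n + 1) := Nat.fib_add_two
    have e2 : Nat.fib (2 * (n + 1) + 1) = Nat.fib (2 * n + 1) + Nat.fib (2 * (n + 1)) :=
      Nat.fib_add_two
    rw [e2, e1]
    push_cast
    refine ⟨by positivity, ?_⟩
    rw [div_mul_eq_mul_div, div_eq_iff (by positivity)]
    linear_combination h2

lemma bestTail_eq_prependBlock (n : ℕ) : bestTail n = prependBlock n (bestTail n) := by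
  obtain ⟨hb1, hb2⟩ := bestNumber_bounds n
  have h := bestNumber_equation n
  rw [prependBlock, ← bestNumber_eq]
  have hz : 0 < 2 + (bestNumber n)⁻¹ := by positivity
  obtain ⟨h1, h2⟩ := iterate_prependOnes_fib hz n
  have hf1 : (0 : ℝ) < Nat.fib (2 * n + 1) := by exact_mod_cast Nat.fib_pos.2 (by omega)
  have hf2 : (0 : ℝ) ≤ Nat.fib (2 * n) := by positivity
  have h3 : (0 : ℝ) < Nat.fib (2 * n) * (2 + (bestNumber n)⁻¹) +
      (Nat.fib (2 * n + 1) - Nat.fib (2 * n)) := by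
    have : 0 < (bestNumber n)⁻¹ := by positivity
    nlinarith
  rw [← eq_div_iff h3.ne'] at h2
  have h4 : bestNumber n - 2 ≠ 0 := by linarith
  rw [h2, bestTail, eq_div_iff h3.ne', inv_mul_eq_div, div_eq_iff h4]
  have h5 : bestNumber n ≠ 0 := by linarith
  field_simp
  linear_combination (-1 : ℝ) * h

/-- Prepending the coefficient `1` to a continued fraction. -/
noncomputable def prependOne (z : ℝ) : ℝ := 1 + z⁻¹

lemma iterate_prependOne_two_mul (n : ℕ) : prependOne^[2 * n] = prependOnes^[n] := by
  rw [Function.iterate_mul]; rfl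

lemma one_lt_iterate_prependOne {z : ℝ} (hz : 1 < z) (n : ℕ) : 1 < prependOne^[n] z := by
  induction n with
  | zero => simpa using hz
  | succ n ih =>
    rw [Function.iterate_succ_apply', prependOne]
    have : 0 < (prependOne^[n] z)⁻¹ := by positivity
    linarith

lemma prependOne_ne_two_add {z t : ℝ} (hz : 1 < z) (ht : 1 < t) : prependOne z ≠ 2 + t⁻¹ := by
  have h1 := inv_lt_one_of_one_lt₀ hz
  have h2 : 0 < t⁻¹ := by positivity
  rw [prependOne]; linarith

lemma eq_of_two_add_inv {s t : ℝ} (h : 2 + s⁻¹ = 2 + t⁻¹) : s = t :=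
  inv_injective (add_left_cancel h)

/-- The positions in the periodic word with period `2, 1, …, 1, 2`. -/
def BestCut (n : ℕ) (x y : ℝ) : Prop :=
  (x = bestNumber n ∧ y = bestNumber n) ∨ ∃ i j : ℕ, i + j = 2 * n ∧
    x = prependOne^[i] (2 + (bestNumber n)⁻¹) ∧ y = prependOne^[j] (2 + (bestNumber n)⁻¹)

lemma one_lt_two_add_inv {z : ℝ} (hz : 0 < z) : 1 < 2 + z⁻¹ := by
  have : 0 < z⁻¹ := by positivity
  linarith

lemma iterate_prependOne_bestTail (n : ℕ) :
    prependOne^[2 * n] (2 + (bestNumber n)⁻¹) = bestTail n := by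
  rw [iterate_prependOne_two_mul, bestNumber_eq, ← prependBlock, ← bestTail_eq_prependBlock]

lemma isCutSystem_bestCut (n : ℕ) : IsCutSystem (BestCut n) where
  one_lt := by
    rintro x y (⟨-, rfl⟩ | ⟨i, j, -, -, rfl⟩)
    · linarith [(bestNumber_bounds n).1]
    · exact one_lt_iterate_prependOne (one_lt_two_add_inv (bestNumber_pos n)) j
  symm := by
    rintro x y (⟨hx, hy⟩ | ⟨i, j, hij, hx, hy⟩)
    · exact .inl ⟨hy, hx⟩
    · exact .inr ⟨j, i, by omega, hy, hx⟩
  digit := by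
    rintro x y (⟨rfl, rfl⟩ | ⟨i, j, hij, rfl, rfl⟩)
    · exact ⟨bestTail n, .inr ⟨bestNumber_eq n,
        .inr ⟨0, 2 * n, by omega, rfl, (iterate_prependOne_bestTail n).symm⟩⟩⟩
    · rcases j with _ | j
      · obtain rfl : i = 2 * n := by omega
        refine ⟨bestNumber n, .inr ⟨rfl, .inl ⟨?_, rfl⟩⟩⟩
        rw [iterate_prependOne_bestTail, ← bestNumber_eq]
      · exact ⟨_, .inl ⟨Function.iterate_succ_apply' prependOne j _,
          .inr ⟨i + 1, j, by omega, (Function.iterate_succ_apply' prependOne i _).symm, rfl⟩⟩⟩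

/-- The normalized dispersion of the lattice of `bestNumber n`. -/
noncomputable def bestValue (n : ℕ) : ℝ := 2 + (5 * bestTail n + 4 + (bestTail n)⁻¹)⁻¹

lemma bestValue_eq (n : ℕ) : bestValue n =
    2 + (2 * bestNumber n * bestTail n + bestNumber n + bestTail n)⁻¹ := by
  have := one_lt_bestTail n
  rw [bestValue, bestNumber_eq]
  congr 2
  field_simp; ring

lemma two_lt_bestValue (n : ℕ) : 2 < bestValue n := by
  have := one_lt_bestTail n
  have : 0 < (5 * bestTail n + 4 + (bestTail n)⁻¹)⁻¹ := by positivity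
  rw [bestValue]; linarith

/-- The two coefficients 2 of the period are mirror images, and the expression is symmetric in `x`
and `t`; all other coefficients are 1. -/
lemma bestCut_le_bestValue {n : ℕ} {x t : ℝ} (ht : 1 < t) (h : BestCut n x (2 + t⁻¹)) :
    2 + (2 * x * t + x + t)⁻¹ ≤ bestValue n := by
  rw [bestValue_eq]
  rcases h with ⟨rfl, h⟩ | ⟨i, j, hij, rfl, h⟩
  · rw [bestNumber_eq] at h
    rw [← eq_of_two_add_inv h]
  rcases j with _ | j
  · obtain rfl : i = 2 * n := by omega
    rw [iterate_prependOne_bestTail, eq_of_two_add_inv h]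
    exact le_of_eq (by ring)
  · rw [Function.iterate_succ_apply'] at h
    exact absurd h.symm (prependOne_ne_two_add
      (one_lt_iterate_prependOne (one_lt_two_add_inv (bestNumber_pos n)) j) ht)

lemma det_genMatrix_ne_zero {x y : ℝ} (hxy : x ≠ y) : (genMatrix x y).det ≠ 0 := by
  rw [genMatrix, Matrix.det_fin_two_of]
  intro h
  exact hxy (by linarith)

lemma isFareyPair_genMatrix {x : ℝ} (hx : 0 < x) : IsFareyPair (genMatrix x (-x⁻¹)) x⁻¹ x := by
  have : IsFareyPair (genMatrix x (-x⁻¹)) x x⁻¹ := by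
    refine ⟨hx, inv_pos.2 hx, ?_⟩
    have := (NBAEquiv.refl (A := genMatrix x (-x⁻¹))).neg_col
    simpa using this
  simpa using this.inv

lemma det_genMatrix_neg_inv_ne_zero {x : ℝ} (hx : 0 < x) : (genMatrix x (-x⁻¹)).det ≠ 0 :=
  det_genMatrix_ne_zero (by have : 0 < x⁻¹ := by positivity
                            linarith)

/-- Cuts contribute at most 2, so the supremum is attained in the middle of the coefficient 2 that
follows the symmetric cut. -/
lemma normalizedDispersion_genMatrix {C : ℝ → ℝ → Prop} (hC : IsCutSystem C) {s : ℝ} (hs : 1 < s)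
    (hCs : C (2 + s⁻¹) (2 + s⁻¹))
    (hV : ∀ x t, 1 < t → C x (2 + t⁻¹) →
      2 + (2 * x * t + x + t)⁻¹ ≤ 2 + (2 * (2 + s⁻¹) * s + (2 + s⁻¹) + s)⁻¹) :
    normalizedDispersion (latticeOf (genMatrix (2 + s⁻¹) (-(2 + s⁻¹)⁻¹))) =
      ENNReal.ofReal (2 + (2 * (2 + s⁻¹) * s + (2 + s⁻¹) + s)⁻¹) := by
  have hx : 0 < 2 + s⁻¹ := by positivity
  have hd := det_genMatrix_neg_inv_ne_zero hx
  have hp := isFareyPair_genMatrix hx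
  refine le_antisymm (hp.normalizedDispersion_le hd hC (fun x y h => ?_) hV hCs) ?_
  · refine (boxArea_le_two (hC.one_lt (hC.symm h)) (hC.one_lt h)).trans ?_
    have : 0 < (2 * (2 + s⁻¹) * s + (2 + s⁻¹) + s)⁻¹ := by positivity
    linarith
  · have h1 := (hp.step (one_lt_two_add_inv (by linarith))).boxArea_le hd
    rwa [add_comm _ (1 : ℝ), show 2 + s⁻¹ - 1 = 1 + s⁻¹ by ring,
      boxArea_mid hx (by linarith)] at h1

lemma normalizedDispersion_best (n : ℕ) :
    normalizedDispersion (latticeOf (genMatrix (bestNumber n) (-(bestNumber n)⁻¹))) =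
      ENNReal.ofReal (bestValue n) := by
  have h := bestNumber_eq n
  have := normalizedDispersion_genMatrix (isCutSystem_bestCut n) (one_lt_bestTail n)
    (by rw [← h]; exact .inl ⟨rfl, rfl⟩)
    (by rw [← h, ← bestValue_eq]; exact fun x t ht h => bestCut_le_bestValue ht h)
  rwa [← h, ← bestValue_eq] at this

/-! ### The limit lattice -/

lemma goldenRatio_sq_eq : φ ^ 2 = 2 + φ⁻¹ := by
  rw [inv_goldenRatio_eq, Real.goldenRatio_sq]; ring

lemma prependOne_goldenRatio : prependOne φ = φ := by
  rw [prependOne, inv_goldenRatio_eq]; ring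

/-- The positions in the word `…1, 1, 2, 2, 1, 1, …`. -/
def LimitCut (x y : ℝ) : Prop :=
  (x = φ ^ 2 ∧ y = φ ^ 2) ∨ (∃ j : ℕ, x = prependOne^[j] (2 + (φ ^ 2)⁻¹) ∧ y = φ) ∨
    ∃ j : ℕ, x = φ ∧ y = prependOne^[j] (2 + (φ ^ 2)⁻¹)

lemma isCutSystem_limitCut : IsCutSystem LimitCut where
  one_lt := by
    have h := Real.one_lt_goldenRatio
    rintro x y (⟨-, rfl⟩ | ⟨j, -, rfl⟩ | ⟨j, -, rfl⟩)
    · nlinarith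
    · exact h
    · exact one_lt_iterate_prependOne (one_lt_two_add_inv (by positivity)) j
  symm := by
    rintro x y (⟨hx, hy⟩ | ⟨j, hx, hy⟩ | ⟨j, hx, hy⟩)
    · exact .inl ⟨hy, hx⟩
    · exact .inr (.inr ⟨j, hy, hx⟩)
    · exact .inr (.inl ⟨j, hy, hx⟩)
  digit := by
    rintro x y (⟨rfl, rfl⟩ | ⟨j, rfl, rfl⟩ | ⟨j, rfl, rfl⟩)
    · exact ⟨φ, .inr ⟨goldenRatio_sq_eq, .inr (.inl ⟨0, rfl, rfl⟩)⟩⟩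
    · exact ⟨φ, .inl ⟨prependOne_goldenRatio.symm,
        .inr (.inl ⟨j + 1, (Function.iterate_succ_apply' prependOne j _).symm, rfl⟩)⟩⟩
    · rcases j with _ | j
      · exact ⟨φ ^ 2, .inr ⟨rfl, .inl ⟨goldenRatio_sq_eq.symm, rfl⟩⟩⟩
      · exact ⟨_, .inl ⟨Function.iterate_succ_apply' prependOne j _,
          .inr (.inr ⟨j, prependOne_goldenRatio, rfl⟩)⟩⟩

lemma normalizedDispersion_limit :
    normalizedDispersion (latticeOf (genMatrix (φ ^ 2) (-(φ ^ 2)⁻¹))) =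
      ENNReal.ofReal ((4 + √5) / 3) := by
  have hφ := Real.one_lt_goldenRatio
  have hv : 2 * (2 + φ⁻¹) * φ + (2 + φ⁻¹) + φ = 6 * φ + 3 := by
    rw [inv_goldenRatio_eq]; nlinarith [Real.goldenRatio_sq]
  have := normalizedDispersion_genMatrix isCutSystem_limitCut hφ
    (.inl ⟨goldenRatio_sq_eq.symm, goldenRatio_sq_eq.symm⟩) ?_
  · rwa [hv, ← goldenRatio_sq_eq, ← limit_sub_two] at this
  rw [← goldenRatio_sq_eq]
  rintro x t ht (⟨rfl, h⟩ | ⟨j, rfl, h⟩ | ⟨j, rfl, h⟩)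
  · rw [goldenRatio_sq_eq] at h
    rw [eq_of_two_add_inv h]
  · exact absurd (prependOne_goldenRatio.trans h.symm) (prependOne_ne_two_add hφ ht)
  · rcases j with _ | j
    · rw [eq_of_two_add_inv h]
      exact le_of_eq (by ring)
    · rw [Function.iterate_succ_apply'] at h
      exact absurd h.symm (prependOne_ne_two_add
        (one_lt_iterate_prependOne (one_lt_two_add_inv (by positivity)) j) ht)

/-! ### Continued fractions and conjugates -/

open GenContFract in
lemma hasContFracExpansion_of_recurrence {y : ℕ → ℝ} {a : ℕ → ℕ}
    (h : ∀ k, y k = a k + (y (k + 1))⁻¹) (h1 : ∀ k, 1 < y (k + 1)) :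
    HasContFracExpansion (y 0) a := by
  have hfloor : ∀ k, ⌊y k⌋ = a k := by
    intro k
    rw [Int.floor_eq_iff, h k]
    have h2 := inv_lt_one_of_one_lt₀ (h1 k)
    have h3 : 0 < (y (k + 1))⁻¹ := inv_pos.2 (by linarith [h1 k])
    push_cast
    constructor <;> linarith
  have hfract : ∀ k, Int.fract (y k) = (y (k + 1))⁻¹ := by
    intro k
    rw [Int.fract, hfloor]
    conv_lhs => rw [h k]
    push_cast; ring
  have hstream : ∀ k, IntFractPair.stream (y 0) k = some (IntFractPair.of (y k)) := by
    intro k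
    induction k with
    | zero => rfl
    | succ k ih =>
      have h3 : (y (k + 1))⁻¹ ≠ 0 := inv_ne_zero (by linarith [h1 k])
      have hfr : (IntFractPair.of (y k)).fr = (y (k + 1))⁻¹ := hfract k
      rw [IntFractPair.stream_succ_of_some ih (by rw [hfr]; exact h3), hfr, inv_inv]
  refine ⟨?_, fun k => ?_⟩
  · rw [of_h_eq_floor, hfloor]; simp
  · rw [get?_of_eq_some_of_succ_get?_intFractPair_stream (hstream (k + 1))]
    have : (IntFractPair.of (y (k + 1))).b = a (k + 1) := hfloor (k + 1)
    rw [this]; simp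

lemma HasContFracExpansion.irrational {x : ℝ} {a : ℕ → ℕ} (h : HasContFracExpansion x a) :
    Irrational x := by
  rintro ⟨q, rfl⟩
  obtain ⟨n, hn⟩ := (GenContFract.terminates_iff_rat ((q : ℚ) : ℝ)).2 ⟨q, rfl⟩
  rw [Stream'.Seq.TerminatedAt, h.2 n] at hn
  simp at hn

lemma hasContFracExpansion_bestNumber (n : ℕ) :
    HasContFracExpansion (bestNumber n) (bestCoeff n) := by
  have hz := one_lt_two_add_inv (bestNumber_pos n)
  let y : ℕ → ℝ := fun k => if k % (2 * n + 2) = 0 then bestNumber n else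
    prependOne^[2 * n + 1 - k % (2 * n + 2)] (2 + (bestNumber n)⁻¹)
  have hy : ∀ k, 1 < y k := by
    intro k
    simp only [y]
    split_ifs
    · linarith [(bestNumber_bounds n).1]
    · exact one_lt_iterate_prependOne hz _
  have h0 : bestNumber n = y 0 := by simp [y]
  rw [h0]
  refine hasContFracExpansion_of_recurrence (fun k => ?_) fun k => hy (k + 1)
  have hk : k % (2 * n + 2) < 2 * n + 2 := Nat.mod_lt _ (by omega)
  have hsucc : (k + 1) % (2 * n + 2) =
      if k % (2 * n + 2) = 2 * n + 1 then 0 else k % (2 * n + 2) + 1 := by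
    rw [Nat.add_mod, Nat.mod_eq_of_lt (show 1 < 2 * n + 2 by omega)]
    split_ifs with h
    · rw [h]; exact Nat.mod_self _
    · exact Nat.mod_eq_of_lt (by omega)
  simp only [y, bestCoeff, hsucc]
  generalize k % (2 * n + 2) = m at hk
  by_cases hm0 : m = 0
  · subst hm0
    have e : ¬ (0 = 2 * n + 1) := by omega
    simp only [if_true, e, if_false, true_or, zero_add, one_ne_zero, Nat.add_sub_cancel]
    rw [iterate_prependOne_bestTail]
    exact_mod_cast bestNumber_eq n
  by_cases hm1 : m = 2 * n + 1
  · subst hm1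
    simp
  · obtain ⟨i, hi⟩ : ∃ i, 2 * n + 1 - m = i + 1 := ⟨2 * n - m, by omega⟩
    have hi' : 2 * n + 1 - (m + 1) = i := by omega
    simp only [hm0, hm1, if_false, or_self, hi, hi', Function.iterate_succ_apply']
    simp [prependOne]

/-- Clearing the denominator of the half trace under the root gives `d = num² + den²`. If `d` were a
square, the number would be rational, against its infinite expansion. -/
lemma isQuadConj_bestNumber (n : ℕ) : IsQuadConj (bestNumber n) (-(bestNumber n)⁻¹) := by
  set r := bestHalfTrace n with hr
  have hd0 : (0 : ℝ) < r.den := by exact_mod_cast r.den_pos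
  have hsqrt : √((r : ℝ) ^ 2 + 1) =
      ((r.den : ℚ)⁻¹ : ℚ) * √((r.num.natAbs ^ 2 + r.den ^ 2 : ℕ) : ℝ) := by
    have h1 : ((r.num.natAbs ^ 2 + r.den ^ 2 : ℕ) : ℝ) = (r.den : ℝ) ^ 2 * ((r : ℝ) ^ 2 + 1) := by
      have h2 : ((r.num.natAbs : ℕ) : ℝ) ^ 2 = (r.num : ℝ) ^ 2 := by
        rw [Nat.cast_natAbs, Int.cast_abs, sq_abs]
      have h3 : (r : ℝ) = r.num / r.den := by exact_mod_cast (Rat.num_div_den r).symm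
      push_cast
      rw [h2, h3]; field_simp
    rw [h1, Real.sqrt_mul (by positivity), Real.sqrt_sq hd0.le]
    push_cast
    field_simp
  have hsq : √((r : ℝ) ^ 2 + 1) ^ 2 = (r : ℝ) ^ 2 + 1 := Real.sq_sqrt (by positivity)
  refine ⟨r, (r.den : ℚ)⁻¹, r.num.natAbs ^ 2 + r.den ^ 2, ?_, ?_, ?_⟩
  · rintro ⟨e, he⟩
    apply (hasContFracExpansion_bestNumber n).irrational
    refine ⟨r + (r.den : ℚ)⁻¹ * e, ?_⟩
    rw [bestNumber, ← hr, hsqrt, he]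
    push_cast
    rw [Real.sqrt_mul_self (by positivity)]
  · rw [← hsqrt]; rfl
  · rw [← hsqrt, neg_eq_iff_eq_neg]
    apply inv_eq_of_mul_eq_one_right
    rw [bestNumber, ← hr]
    linear_combination hsq

/-! ### Monotonicity and limit of the values -/

lemma fib_cassini (n : ℕ) : (Nat.fib (2 * n + 1) : ℝ) ^ 2 -
    Nat.fib (2 * n + 1) * Nat.fib (2 * n) - (Nat.fib (2 * n) : ℝ) ^ 2 = 1 := by
  induction n with
  | zero => simp
  | succ n ih =>
    have e1 : Nat.fib (2 * (n + 1)) = Nat.fib (2 * n) + Nat.fib (2 * n + 1) := Nat.fib_add_two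
    have e2 : Nat.fib (2 * (n + 1) + 1) = Nat.fib (2 * n + 1) + Nat.fib (2 * (n + 1)) :=
      Nat.fib_add_two
    rw [e2, e1]; push_cast
    linear_combination ih

lemma bestHalfTrace_pos (n : ℕ) : (0 : ℝ) < bestHalfTrace n := by
  have h1 : (0 : ℝ) < Nat.fib (2 * n + 1) := by exact_mod_cast Nat.fib_pos.2 (by omega)
  rw [bestHalfTrace]; push_cast; positivity

/-- After cross-multiplication, the difference is a positive multiple of the left side of Cassini's
identity. -/
lemma bestHalfTrace_lt_succ (n : ℕ) : (bestHalfTrace n : ℝ) < bestHalfTrace (n + 1) := by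
  have h1 : (0 : ℝ) < Nat.fib (2 * n + 1) := by exact_mod_cast Nat.fib_pos.2 (by omega)
  have e1 : Nat.fib (2 * (n + 1)) = Nat.fib (2 * n) + Nat.fib (2 * n + 1) := Nat.fib_add_two
  have e2 : Nat.fib (2 * (n + 1) + 1) = Nat.fib (2 * n + 1) + Nat.fib (2 * (n + 1)) :=
    Nat.fib_add_two
  have h := fib_cassini n
  rw [bestHalfTrace, bestHalfTrace, e2, e1]
  push_cast
  rw [div_lt_div_iff₀ (by positivity) (by positivity)]
  nlinarith

lemma bestNumber_lt_succ (n : ℕ) : bestNumber n < bestNumber (n + 1) := by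
  have h0 := bestHalfTrace_pos n
  have h := bestHalfTrace_lt_succ n
  rw [bestNumber, bestNumber]
  refine add_lt_add_of_lt_of_le h (Real.sqrt_le_sqrt ?_)
  gcongr

lemma bestTail_succ_lt (n : ℕ) : bestTail (n + 1) < bestTail n := by
  have h1 := (bestNumber_bounds n).1
  have h2 := bestNumber_lt_succ n
  exact inv_strictAnti₀ (by linarith) (by linarith)

/-- The tails decrease, and `5t + 4 + 1/t` increases for `t > 1`. -/
lemma strictMono_bestValue : StrictMono bestValue := by
  refine strictMono_nat_of_lt_succ fun n => ?_
  have h1 := bestTail_succ_lt n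
  have h2 := one_lt_bestTail (n + 1)
  have h3 := one_lt_bestTail n
  rw [bestValue, bestValue]
  set a := bestTail (n + 1)
  set b := bestTail n
  have h4 : a⁻¹ - b⁻¹ = (b - a) / (a * b) := by field_simp
  have h5 : (b - a) / (a * b) ≤ b - a := div_le_self (by linarith) (by nlinarith)
  have : (5 * b + 4 + b⁻¹)⁻¹ < (5 * a + 4 + a⁻¹)⁻¹ :=
    inv_strictAnti₀ (by positivity) (by linarith)
  linarith

/-- The tail and `φ` are images of bounded starting points under the same `n`-fold contraction by
`1/4`. -/
lemma tendsto_bestTail : Filter.Tendsto bestTail Filter.atTop (nhds φ) := by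
  obtain ⟨hφ, hφ'⟩ := goldenRatio_bounds
  rw [tendsto_iff_dist_tendsto_zero]
  have lim : Filter.Tendsto (fun n : ℕ => 3 * (1 / 4 : ℝ) ^ n) Filter.atTop (nhds (3 * 0)) :=
    (tendsto_pow_atTop_nhds_zero_of_lt_one (by norm_num) (by norm_num)).const_mul 3
  rw [mul_zero] at lim
  refine squeeze_zero (fun _ => dist_nonneg) (fun n => ?_) lim
  have hz := one_lt_two_add_inv (bestNumber_pos n)
  have hfix : prependOnes^[n] φ = φ := Function.iterate_fixed prependOnes_goldenRatio n
  have h := abs_iterate_prependOnes_sub_le hz.le (show 1 ≤ φ by linarith) n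
  rw [hfix, ← iterate_prependOne_two_mul, iterate_prependOne_bestTail] at h
  rw [Real.dist_eq]
  refine h.trans ?_
  rw [one_div, inv_pow, ← div_eq_mul_inv]
  gcongr
  have h1 := (bestNumber_bounds n).1
  have h2 : (bestNumber n)⁻¹ < 1 := inv_lt_one_of_one_lt₀ (by linarith)
  rw [abs_le]; constructor <;> linarith

lemma tendsto_bestValue : Filter.Tendsto bestValue Filter.atTop (nhds ((4 + √5) / 3)) := by
  have h0 := Real.goldenRatio_pos
  have h : (4 + √5) / 3 = 2 + (5 * φ + 4 + φ⁻¹)⁻¹ := by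
    rw [limit_sub_two, inv_goldenRatio_eq]; congr 2; ring
  rw [h]
  exact ((((tendsto_bestTail.const_mul 5).add_const 4).add
    (tendsto_bestTail.inv₀ h0.ne')).inv₀ (by positivity)).const_add 2

lemma bestValue_lt_limit (n : ℕ) : bestValue n < (4 + √5) / 3 :=
  (strictMono_bestValue (Nat.lt_succ_self n)).trans_le
    (strictMono_bestValue.monotone.ge_of_tendsto tendsto_bestValue (n + 1))

/-! ### The smallest normalized dispersions -/

/-- The generators of the lattices with the smallest normalized dispersions, in increasing order. -/
noncomputable def bestMatrix : ℕ → Matrix (Fin 2) (Fin 2) ℝ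
  | 0 => !![1, φ; 1, ψ]
  | n + 1 => genMatrix (bestNumber n) (-(bestNumber n)⁻¹)

/-- The normalized dispersions of the lattices generated by `bestMatrix`. -/
noncomputable def bestDispersion : ℕ → ℝ
  | 0 => φ ^ 3 / √5
  | n + 1 => bestValue n

lemma det_bestMatrix_ne_zero : ∀ k, (bestMatrix k).det ≠ 0
  | 0 => det_golden_ne_zero
  | n + 1 => det_genMatrix_neg_inv_ne_zero (bestNumber_pos n)

lemma normalizedDispersion_bestMatrix : ∀ k,
    normalizedDispersion (latticeOf (bestMatrix k)) = ENNReal.ofReal (bestDispersion k)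
  | 0 => normalizedDispersion_golden
  | n + 1 => normalizedDispersion_best n

lemma sqrt_five_bounds : 2.236067 < √5 ∧ √5 < 2.236068 :=
  ⟨Real.lt_sqrt_of_sq_lt (by norm_num), by rw [Real.sqrt_lt' (by norm_num)]; norm_num⟩

lemma sqrt_two_bounds : 1.414213 < √2 ∧ √2 < 1.4142136 :=
  ⟨Real.lt_sqrt_of_sq_lt (by norm_num), by rw [Real.sqrt_lt' (by norm_num)]; norm_num⟩

lemma golden_value_mem : φ ^ 3 / √5 ∈ Set.Ico (1.89442 : ℝ) 1.89443 := by
  obtain ⟨h1, h2⟩ := sqrt_five_bounds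
  have h5 : √5 ^ 2 = 5 := Real.sq_sqrt (by norm_num)
  have h3 : φ ^ 3 = 2 + √5 := by
    rw [Real.goldenRatio]; linear_combination (3 / 8 + √5 / 8) * h5
  rw [h3]
  constructor
  · rw [le_div_iff₀ (by linarith)]; linarith
  · rw [div_lt_iff₀ (by linarith)]; linarith

lemma strictMono_bestDispersion : StrictMono bestDispersion := by
  refine strictMono_nat_of_lt_succ fun k => ?_
  rcases k with _ | n
  · have h1 := golden_value_mem.2
    have h2 := two_lt_bestValue 0
    change φ ^ 3 / √5 < bestValue 0
    linarith
  · exact strictMono_bestValue (Nat.lt_succ_self n)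

lemma bestDispersion_pos (k : ℕ) : 0 < bestDispersion k := by
  have h0 : 0 < bestDispersion 0 := by
    have := golden_value_mem.1
    change 0 < φ ^ 3 / √5
    linarith
  exact h0.trans_le (strictMono_bestDispersion.monotone (Nat.zero_le k))

lemma strictMono_ofReal_bestDispersion :
    StrictMono fun k => ENNReal.ofReal (bestDispersion k) := fun _ _ h =>
  (ENNReal.ofReal_lt_ofReal_iff (bestDispersion_pos _)).2 (strictMono_bestDispersion h)

lemma ofReal_bestDispersion_lt_limit (k : ℕ) :
    ENNReal.ofReal (bestDispersion k) < ENNReal.ofReal ((4 + √5) / 3) := by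
  refine (strictMono_ofReal_bestDispersion (Nat.lt_succ_self k)).trans ?_
  rw [ENNReal.ofReal_lt_ofReal_iff (by positivity)]
  exact bestValue_lt_limit k

lemma exists_nbaEquiv_bestMatrix {A : Matrix (Fin 2) (Fin 2) ℝ} (hA : A.det ≠ 0)
    (hlim : normalizedDispersion (latticeOf A) < ENNReal.ofReal ((4 + √5) / 3)) :
    ∃ k, NBAEquiv A (bestMatrix k) := by
  obtain ⟨x, y, hxy⟩ := exists_latticeCut hA hlim
  rcases (isCutSystem_latticeCut hA hlim).classification (isSmall_latticeCut hA hlim)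
    (fun n => (one_lt_bestTail n).le) bestTail_eq_prependBlock hxy with ⟨-, -, h⟩ | ⟨n, -, -, h⟩
  · refine ⟨0, ?_⟩
    have := h.inv.equiv
    rwa [inv_inv, Real.inv_goldenRatio, neg_neg] at this
  · refine ⟨n + 1, ?_⟩
    have := h.inv.equiv.neg_col
    rwa [inv_inv, ← bestNumber_eq] at this

lemma normalizedDispersion_eq_iff {A : Matrix (Fin 2) (Fin 2) ℝ} (hA : A.det ≠ 0) (k : ℕ) :
    normalizedDispersion (latticeOf A) = normalizedDispersion (latticeOf (bestMatrix k)) ↔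
      NBAEquiv A (bestMatrix k) := by
  refine ⟨fun h => ?_, fun h => (h.invariant hA).2.symm⟩
  rw [normalizedDispersion_bestMatrix] at h
  obtain ⟨m, hm⟩ := exists_nbaEquiv_bestMatrix hA (h.trans_lt (ofReal_bestDispersion_lt_limit k))
  have h2 := (hm.invariant hA).2
  rw [normalizedDispersion_bestMatrix, h] at h2
  rwa [strictMono_ofReal_bestDispersion.injective h2] at hm

lemma normalizedDispersion_mem {A : Matrix (Fin 2) (Fin 2) ℝ} (hA : A.det ≠ 0) :
    normalizedDispersion (latticeOf A) ∈ normalizedDispersions := by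
  obtain ⟨h1, h2, -⟩ := isZLattice_latticeOf hA
  exact ⟨_, h1, h2, rfl⟩

/-- Below the limit only the listed values occur, and they increase strictly; so exactly `k` values
lie below the one of index `k`, which counts from 0. -/
lemma isKthSmallest_bestMatrix (k : ℕ) : IsKthSmallest normalizedDispersions (k + 1)
    (normalizedDispersion (latticeOf (bestMatrix k))) := by
  refine ⟨normalizedDispersion_mem (det_bestMatrix_ne_zero k), ?_⟩
  have : {x ∈ normalizedDispersions | x < normalizedDispersion (latticeOf (bestMatrix k))} =
      (fun k => ENNReal.ofReal (bestDispersion k)) '' (Finset.range k : Set ℕ) := by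
    ext v
    rw [normalizedDispersion_bestMatrix, Set.mem_image]
    constructor
    · rintro ⟨⟨L, h1, h2, rfl⟩, hv⟩
      obtain ⟨A, hA, rfl⟩ := exists_latticeOf_eq L
      obtain ⟨m, hm⟩ := exists_nbaEquiv_bestMatrix hA (hv.trans (ofReal_bestDispersion_lt_limit k))
      have h3 := (hm.invariant hA).2
      rw [normalizedDispersion_bestMatrix] at h3
      rw [← h3] at hv
      exact ⟨m, by simpa using strictMono_ofReal_bestDispersion.lt_iff_lt.1 hv, h3⟩
    · rintro ⟨m, hm, rfl⟩
      refine ⟨?_, strictMono_ofReal_bestDispersion (by simpa using hm)⟩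
      rw [← normalizedDispersion_bestMatrix]
      exact normalizedDispersion_mem (det_bestMatrix_ne_zero m)
  rw [this, strictMono_ofReal_bestDispersion.injective.encard_image,
    Set.encard_coe_eq_coe_finsetCard, Finset.card_range]
  push_cast; rfl

lemma bestNumber_zero : bestNumber 0 = 1 + √2 := by
  norm_num [bestNumber, bestHalfTrace]

lemma inv_one_add_sqrt_two : (1 + √2)⁻¹ = √2 - 1 :=
  inv_eq_of_mul_eq_one_right (by nlinarith [Real.sq_sqrt (show (0 : ℝ) ≤ 2 by norm_num)])

lemma nbaEquiv_bestMatrix_one {A : Matrix (Fin 2) (Fin 2) ℝ} :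
    NBAEquiv A (bestMatrix 1) ↔ NBAEquiv A !![1, 1 + √2; 1, 1 - √2] := by
  have h : bestMatrix 1 = !![1, -(1 + √2); 1, -(1 - √2)] := by
    rw [bestMatrix, genMatrix, bestNumber_zero, inv_one_add_sqrt_two]
    congr 1; ring_nf
  rw [h]
  exact ⟨fun h => by simpa only [neg_neg] using h.neg_col, fun h => h.neg_col⟩

lemma normalizedDispersion_silver :
    normalizedDispersion (latticeOf !![1, 1 + √2; 1, 1 - √2]) =
      normalizedDispersion (latticeOf (bestMatrix 1)) :=
  ((nbaEquiv_bestMatrix_one.1 .refl).invariant (det_bestMatrix_ne_zero 1)).2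

lemma bestValue_zero : bestValue 0 = (3 + 2 * √2) / (2 * √2) := by
  have h2 : √2 ^ 2 = 2 := Real.sq_sqrt (by norm_num)
  have h0 : 0 < √2 := by positivity
  have h1 : bestTail 0 = 1 + √2 := by
    rw [bestTail, bestNumber_zero, inv_eq_iff_eq_inv, inv_one_add_sqrt_two]; ring
  have h3 : 5 * (1 + √2) + 4 + (√2 - 1) = 8 + 6 * √2 := by ring
  rw [bestValue, h1, inv_one_add_sqrt_two, h3]
  field_simp
  nlinarith

lemma silver_value_mem : (3 + 2 * √2) / (2 * √2) ∈ Set.Ico (2.06066 : ℝ) 2.06067 := by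
  obtain ⟨h1, h2⟩ := sqrt_two_bounds
  constructor
  · rw [le_div_iff₀ (by linarith)]; linarith
  · rw [div_lt_iff₀ (by linarith)]; linarith

lemma limit_value_mem : (4 + √5) / 3 ∈ Set.Ico (2.07868 : ℝ) 2.07869 := by
  obtain ⟨h1, h2⟩ := sqrt_five_bounds
  constructor <;> linarith

lemma hasContFracExpansion_goldenRatio_sq :
    HasContFracExpansion (φ ^ 2) (fun k => if k = 0 then 2 else 1) := by
  refine hasContFracExpansion_of_recurrence (y := fun k => if k = 0 then φ ^ 2 else φ)
    (fun k => ?_) fun k => by simpa using Real.one_lt_goldenRatio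
  rcases k with _ | k
  · simpa using goldenRatio_sq_eq
  · simpa [prependOne] using prependOne_goldenRatio.symm

lemma hasContFracExpansion_inv_goldenRatio_sq :
    HasContFracExpansion ((φ ^ 2)⁻¹) (fun k => if k = 0 then 0 else if k = 1 then 2 else 1) := by
  have hφ := Real.one_lt_goldenRatio
  refine hasContFracExpansion_of_recurrence
    (y := fun k => if k = 0 then (φ ^ 2)⁻¹ else if k = 1 then φ ^ 2 else φ)
    (fun k => ?_) fun k => ?_
  · rcases k with _ | _ | k
    · simp
    · simpa using goldenRatio_sq_eq
    · simpa [prependOne] using prependOne_goldenRatio.symm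
  · rcases k with _ | k
    · simpa using one_lt_pow₀ hφ two_ne_zero
    · simpa using hφ

theorem mainTheorem4 :
    -- the smallest normalized dispersion
    (IsKthSmallest normalizedDispersions 1 (normalizedDispersion (latticeOf !![1, φ; 1, ψ])) ∧
      normalizedDispersion (latticeOf !![1, φ; 1, ψ]) = ENNReal.ofReal (φ ^ 3 / √5) ∧
      φ ^ 3 / √5 ∈ Set.Ico (1.89442 : ℝ) 1.89443 ∧
      ∀ A : Matrix (Fin 2) (Fin 2) ℝ, A.det ≠ 0 →
        (normalizedDispersion (latticeOf A) = normalizedDispersion (latticeOf !![1, φ; 1, ψ]) ↔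
          NBAEquiv A !![1, φ; 1, ψ])) ∧
    -- the second smallest normalized dispersion
    (IsKthSmallest normalizedDispersions 2
        (normalizedDispersion (latticeOf !![1, 1 + √2; 1, 1 - √2])) ∧
      normalizedDispersion (latticeOf !![1, 1 + √2; 1, 1 - √2]) =
        ENNReal.ofReal ((3 + 2 * √2) / (2 * √2)) ∧
      (3 + 2 * √2) / (2 * √2) ∈ Set.Ico (2.06066 : ℝ) 2.06067 ∧
      ∀ A : Matrix (Fin 2) (Fin 2) ℝ, A.det ≠ 0 →
        (normalizedDispersion (latticeOf A) =
            normalizedDispersion (latticeOf !![1, 1 + √2; 1, 1 - √2]) ↔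
          NBAEquiv A !![1, 1 + √2; 1, 1 - √2])) ∧
    -- all further ones (`n = 0` is the second smallest again), and their limit
    (∃ Δ Δ' : ℕ → ℝ,
      (∀ n, HasContFracExpansion (Δ n) (bestCoeff n) ∧ IsQuadConj (Δ n) (Δ' n) ∧
        IsKthSmallest normalizedDispersions (n + 2)
          (normalizedDispersion (latticeOf (genMatrix (Δ n) (Δ' n)))) ∧
        ∀ A : Matrix (Fin 2) (Fin 2) ℝ, A.det ≠ 0 →
          (normalizedDispersion (latticeOf A) =
              normalizedDispersion (latticeOf (genMatrix (Δ n) (Δ' n))) ↔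
            NBAEquiv A (genMatrix (Δ n) (Δ' n)))) ∧
      StrictMono (fun n => normalizedDispersion (latticeOf (genMatrix (Δ n) (Δ' n)))) ∧
      Filter.Tendsto (fun n => normalizedDispersion (latticeOf (genMatrix (Δ n) (Δ' n))))
        Filter.atTop (nhds (ENNReal.ofReal ((4 + √5) / 3)))) ∧
    -- the limit is the normalized dispersion of an explicit lattice
    (HasContFracExpansion (φ ^ 2) (fun k => if k = 0 then 2 else 1) ∧
      HasContFracExpansion ((φ ^ 2)⁻¹) (fun k => if k = 0 then 0 else if k = 1 then 2 else 1) ∧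
      normalizedDispersion (latticeOf (genMatrix (φ ^ 2) (-(φ ^ 2)⁻¹))) =
        ENNReal.ofReal ((4 + √5) / 3) ∧
      (4 + √5) / 3 ∈ Set.Ico (2.07868 : ℝ) 2.07869) := by
  refine ⟨⟨isKthSmallest_bestMatrix 0, normalizedDispersion_golden, golden_value_mem,
      fun A hA => normalizedDispersion_eq_iff hA 0⟩,
    ⟨?_, ?_, silver_value_mem, fun A hA => ?_⟩,
    ⟨bestNumber, fun n => -(bestNumber n)⁻¹,
      fun n => ⟨hasContFracExpansion_bestNumber n, isQuadConj_bestNumber n,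
        isKthSmallest_bestMatrix (n + 1), fun A hA => normalizedDispersion_eq_iff hA (n + 1)⟩,
      ?_, ?_⟩,
    hasContFracExpansion_goldenRatio_sq, hasContFracExpansion_inv_goldenRatio_sq,
    normalizedDispersion_limit, limit_value_mem⟩
  · rw [normalizedDispersion_silver]
    exact isKthSmallest_bestMatrix 1
  · rw [normalizedDispersion_silver, normalizedDispersion_bestMatrix, ← bestValue_zero]
    rfl
  · rw [normalizedDispersion_silver, normalizedDispersion_eq_iff hA, nbaEquiv_bestMatrix_one]
  · simp only [normalizedDispersion_best]
    exact fun m n h => strictMono_ofReal_bestDispersion (Nat.succ_lt_succ h)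
  · simp only [normalizedDispersion_best]
    exact ENNReal.tendsto_ofReal tendsto_bestValue
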